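/- Let $m,n\ge 1$ be coprime integers and let $$\mathbb H_{m/n}=\{(z_1,z_2)\in\mathbb C^2 : |z_1|^{m/n}<|z_2|<1\},$$ equipped with Lebesgue measure. For $2\le p<\infty$ let $A^p(\mathbb H_{m/n})$ be the space of holomorphic functions on $\mathbb H_{m/n}$ that lie in $L^p(\mathbb H_{m/n})$ (since $\mathbb H_{m/n}$ is bounded, $A^p(\mathbb H_{m/n})\subset L^p(\mathbb H_{m/n})\subset L^2(\mathbb H_{m/n})$), let $G^{2,p}$ be the closure of the linear span of $A^p(\mathbb H_{m/n})$ in the $L^2$ norm, and let the sub-Bergman projection $\widetilde{B^p}$ be the orthogonal projection of $L^2(\mathbb H_{m/n})$ onto $G^{2,p}$. Let $2\le p<\infty$ and $g\in L^p(\mathbb H_{m/n})$. Then $\widetilde{B^p}g\in A^p(\mathbb H_{m/n})$ (that is, it agrees almost everywhere with a function in $A^p(\mathbb H_{m/n})$), and for every $h\in A^p(\mathbb H_{m/n})$ $$\|g-\widetilde{B^p}g\|_{L^2(\mathbb H_{m/n})}\le\|g-h\|_{L^2(\mathbb H_{m/n})},$$ with equality if and only if $h=\widetilde{B^p}g$ on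 $\mathbb H_{m/n}$. -/

import Mathlib

open MeasureTheory Set

/-- The power-generalized Hartogs triangle of exponent `γ`. -/
def hartogs (γ : ℝ) : Set (ℂ × ℂ) :=
  {z | ‖z.1‖ ^ γ < ‖z.2‖ ∧ ‖z.2‖ < 1}

/-- Lebesgue measure on `Ω ⊆ ℂ²`. -/
noncomputable abbrev volOn (Ω : Set (ℂ × ℂ)) : Measure (ℂ × ℂ) := volume.restrict Ω

/-- The Bergman space `A^p(Ω)`: functions that are holomorphic and `p`-th power integrable on `Ω`.
(Only the values on `Ω` matter.) -/
def bergmanSpace (p : ENNReal) (Ω : Set (ℂ × ℂ)) : Set (ℂ × ℂ → ℂ) :=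
  {f | DifferentiableOn ℂ f Ω ∧ MemLp f p (volOn Ω)}

/-- `G^{2,p}(Ω)`: the closed linear span of `A^p(Ω)` in the `L²` norm.
It is taken in `L²(Ω)`, where `A²(Ω)` is a closed subspace, so the closures in `A²(Ω)` and in
`L²(Ω)` agree. -/
noncomputable def closedSpanBergman (p : ENNReal) (Ω : Set (ℂ × ℂ)) :
    Submodule ℂ (Lp ℂ 2 (volOn Ω)) :=
  (Submodule.span ℂ
    {f : Lp ℂ 2 (volOn Ω) | ∃ h ∈ bergmanSpace p Ω, f =ᵐ[volOn Ω] h}).topologicalClosure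

/-- The `L^p` sub-Bergman projection: the orthogonal projection of `L²(Ω)` onto `G^{2,p}(Ω)`. -/
noncomputable def subBergmanProjection (p : ENNReal) (Ω : Set (ℂ × ℂ)) :
    Lp ℂ 2 (volOn Ω) →L[ℂ] Lp ℂ 2 (volOn Ω) :=
  haveI : CompleteSpace (closedSpanBergman p Ω) :=
    Submodule.topologicalClosure.completeSpace _
  (closedSpanBergman p Ω).starProjection

theorem hartogs_subset_bidisc {γ : ℝ} (hγ : 0 < γ) :
    hartogs γ ⊆ Metric.ball (0 : ℂ) 1 ×ˢ Metric.ball (0 : ℂ) 1 := by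
  rintro ⟨z, w⟩ ⟨h1, h2⟩
  refine ⟨?_, by simpa using h2⟩
  by_contra hz
  have hz' : 1 ≤ ‖z‖ := by simpa using hz
  exact absurd (h1.trans h2) (not_lt.2 (Real.one_le_rpow hz' hγ.le))

theorem volume_hartogs_lt_top {γ : ℝ} (hγ : 0 < γ) : volume (hartogs γ) < ⊤ :=
  (measure_mono (hartogs_subset_bidisc hγ)).trans_lt
    ((Metric.isBounded_ball.prod Metric.isBounded_ball).measure_lt_top)

/-- `L^p ⊆ L²` on `hartogs (m / n)` when `2 ≤ p`. -/
theorem memLp_two_hartogs {m n : ℕ} (hm : 0 < m) (hn : 0 < n) {p : ℝ} (hp : 2 ≤ p)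
    {g : ℂ × ℂ → ℂ} (hg : MemLp g (ENNReal.ofReal p) (volOn (hartogs ((m : ℝ) / n)))) :
    MemLp g 2 (volOn (hartogs ((m : ℝ) / n))) := by
  haveI : IsFiniteMeasure (volOn (hartogs ((m : ℝ) / n))) :=
    isFiniteMeasure_restrict.2 (volume_hartogs_lt_top (by positivity)).ne
  refine hg.mono_exponent ?_
  simpa using ENNReal.ofReal_le_ofReal hp

open scoped ComplexConjugate

/-! Integrating over slices shows that `z₁ ^ a * z₂ ^ b` is in `L^p` exactly when `a ≥ 0` and `(n *
a + m * b) * p > -2 * (m + n)`. For fixed `p` the second condition says `n * a + m * b ≥ K` for one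
integer `K` (`exists_least_exponent`). Let `T` be the integral operator whose kernel
(`monomialKernel`) sums all monomials with `a ≥ 0` and `n * a + m * b ≥ K`, each divided by its
squared `L²` norm. The theorem follows from three properties of `T`.

(1) `T` maps `L^p` into `A^p`. Sorting the monomials by `a` modulo `m` turns the kernel into a
finite sum of products of two arithmetic-geometric series, so its modulus is at most a constant
times `|z₂ w₂| ^ (K / m)` times two squared Cauchy factors (`norm_monomialKernel_le`). Forelli–Rudin
estimates and a Schur test bound the majorant on `L^p` (`lintegral_hartogsMajorant_rpow_le`). The
condition on the power of `|z₂|` is `K * p > -2 * (m + n)`, which holds because `K` itself is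
admissible.

(2) `T` is symmetric (`integral_conj_mul_monomialProjection`): the kernel is Hermitian, and the
majorant bound justifies Fubini.

(3) `T f = f` for `f` in `A^p`, off the null set `z₁ = 0` (`monomialProjection_eq_self`). Both sides
have the same Fourier coefficients on every torus. The coefficients of `f` are monomials by Cauchy's
theorem on annuli, and those outside the admissible range vanish, since otherwise the corresponding
monomial would lie in `L^p`.

Hence for `h` in `A^p`, `⟨h, g - T g⟩ = ⟨h, g⟩ - ⟨T h, g⟩ = 0`, while `T g` lies in `A^p`. So `T g`
is the orthogonal projection of `g`, and minimality with its equality case is Pythagoras together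
with continuity on the open domain. -/

/-! ### Geometry of the domain and integrals of powers -/

theorem mem_hartogs_iff {m n : ℕ} (hn : 0 < n) {z : ℂ × ℂ} :
    z ∈ hartogs ((m : ℝ) / n) ↔ ‖z.1‖ ^ m < ‖z.2‖ ^ n ∧ ‖z.2‖ < 1 := by
  have h : (‖z.1‖ ^ ((m : ℝ) / n)) ^ n = ‖z.1‖ ^ m := by
    rw [← Real.rpow_natCast, ← Real.rpow_mul (norm_nonneg _), div_mul_cancel₀ _ (by positivity),
      Real.rpow_natCast]
  rw [hartogs, mem_ofPred_eq, ← h,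
    pow_lt_pow_iff_left₀ (by positivity) (norm_nonneg _) hn.ne']

theorem isOpen_hartogs {m n : ℕ} (hn : 0 < n) : IsOpen (hartogs ((m : ℝ) / n)) := by
  have : hartogs ((m : ℝ) / n) = {z | ‖z.1‖ ^ m < ‖z.2‖ ^ n} ∩ {z | ‖z.2‖ < 1} :=
    Set.ext fun z => mem_hartogs_iff hn
  rw [this]
  exact (isOpen_lt (by fun_prop) (by fun_prop)).inter (isOpen_lt (by fun_prop) (by fun_prop))

theorem snd_ne_zero_of_mem_hartogs {m n : ℕ} (hn : 0 < n) {z : ℂ × ℂ}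
    (hz : z ∈ hartogs ((m : ℝ) / n)) : z.2 ≠ 0 := by
  intro h
  have := ((mem_hartogs_iff hn).1 hz).1
  rw [h, norm_zero, zero_pow hn.ne'] at this
  exact absurd this (not_lt.2 (by positivity))

theorem hartogs_slice {m n : ℕ} (hm : 0 < m) (hn : 0 < n) {w : ℂ} (hw : ‖w‖ < 1) :
    {z : ℂ | (z, w) ∈ hartogs ((m : ℝ) / n)} = Metric.ball 0 (‖w‖ ^ ((n : ℝ) / m)) := by
  ext z
  have h : (‖w‖ ^ ((n : ℝ) / m)) ^ m = ‖w‖ ^ n := by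
    rw [← Real.rpow_natCast, ← Real.rpow_mul (norm_nonneg _), div_mul_cancel₀ _ (by positivity),
      Real.rpow_natCast]
  rw [mem_ofPred_eq, mem_hartogs_iff hn, mem_ball_zero_iff, ← h,
    pow_lt_pow_iff_left₀ (norm_nonneg _) (by positivity) hm.ne']
  simp [hw]

/-- Integration over a power-generalized Hartogs triangle by slices in the first variable. -/
theorem lintegral_hartogs {m n : ℕ} (hm : 0 < m) (hn : 0 < n) {F : ℂ × ℂ → ENNReal}
    (hF : Measurable F) :
    ∫⁻ z, F z ∂(volOn (hartogs ((m : ℝ) / n))) =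
      ∫⁻ w in Metric.ball (0 : ℂ) 1, ∫⁻ z in Metric.ball (0 : ℂ) (‖w‖ ^ ((n : ℝ) / m)),
        F (z, w) := by
  have hH := (isOpen_hartogs (m := m) hn).measurableSet
  rw [← lintegral_indicator hH, Measure.volume_eq_prod,
    lintegral_prod_symm _ (hF.indicator hH).aemeasurable,
    ← lintegral_indicator Metric.isOpen_ball.measurableSet]
  refine lintegral_congr fun w => ?_
  by_cases hw : ‖w‖ < 1
  · rw [indicator_of_mem (by simpa using hw), ← lintegral_indicator Metric.isOpen_ball.measurableSet]
    refine lintegral_congr fun z => ?_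
    have := Set.ext_iff.1 (hartogs_slice hm hn hw) z
    simp only [mem_ofPred_eq] at this
    by_cases hz : (z, w) ∈ hartogs ((m : ℝ) / n)
    · rw [indicator_of_mem hz, indicator_of_mem (this.1 hz)]
    · rw [indicator_of_notMem hz, indicator_of_notMem (fun h => hz (this.2 h))]
  · rw [indicator_of_notMem (by simpa using hw)]
    rw [lintegral_eq_zero_iff' (by
      exact ((hF.indicator hH).comp (by fun_prop : Measurable fun z : ℂ => (z, w))).aemeasurable)]
    refine Filter.Eventually.of_forall fun z => ?_
    exact indicator_of_notMem (fun h => hw ((mem_hartogs_iff hn).1 h).2) _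

/-- Integration in polar coordinates of a radial function on a disc. -/
theorem lintegral_ball_radial {f : ℝ → ENNReal} (hf : Measurable f) (R : ℝ) :
    ∫⁻ w in Metric.ball (0 : ℂ) R, f ‖w‖ =
      ENNReal.ofReal (2 * Real.pi) * ∫⁻ r in Ioo 0 R, ENNReal.ofReal r * f r := by
  rw [← lintegral_indicator Metric.isOpen_ball.measurableSet, ← Complex.lintegral_comp_polarCoord_symm]
  have h1 : ∀ q : ℝ × ℝ, q ∈ polarCoord.target →
      ENNReal.ofReal q.1 • (Metric.ball (0 : ℂ) R).indicator (fun w => f ‖w‖)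
        (Complex.polarCoord.symm q) = (Iio R).indicator (fun r => ENNReal.ofReal r * f r) q.1 := by
    intro q hq
    have h0 : 0 < q.1 := by simpa [polarCoord] using hq.1
    have hn : ‖Complex.polarCoord.symm q‖ = q.1 := by
      rw [Complex.norm_polarCoord_symm, abs_of_pos h0]
    by_cases h : q.1 < R
    · rw [indicator_of_mem (by simpa [abs_of_pos h0] using h), indicator_of_mem (by simpa using h), hn,
        smul_eq_mul]
    · rw [indicator_of_notMem (by simpa [abs_of_pos h0] using h), indicator_of_notMem (by simpa using h)]
      simp
  rw [setLIntegral_congr_fun polarCoord.open_target.measurableSet h1]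
  have hmeas : Measurable ((Iio R).indicator (fun r => ENNReal.ofReal r * f r)) :=
    (by fun_prop : Measurable (fun r => ENNReal.ofReal r * f r)).indicator measurableSet_Iio
  have ht : (polarCoord.target : Set (ℝ × ℝ)) = Ioi 0 ×ˢ Ioo (-Real.pi) Real.pi := rfl
  rw [ht, Measure.volume_eq_prod, ← Measure.prod_restrict,
    lintegral_prod (fun q : ℝ × ℝ => (Iio R).indicator (fun r => ENNReal.ofReal r * f r) q.1)
      (hmeas.comp measurable_fst).aemeasurable]
  simp only [lintegral_const, Measure.restrict_apply MeasurableSet.univ, univ_inter, Real.volume_Ioo]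
  rw [lintegral_mul_const _ hmeas, mul_comm]
  congr 1
  · congr 1; ring
  · rw [← lintegral_indicator measurableSet_Ioi, ← lintegral_indicator measurableSet_Ioo]
    refine lintegral_congr fun r => ?_
    by_cases h : 0 < r <;> by_cases h' : r < R <;> simp [h, h', indicator]

/-- The divergent case is recorded as `⊤` because both directions are needed: finite values give the
norms of monomials, infinite ones exclude monomials from `A^p`. -/
theorem setLIntegral_Ioo_rpow {R e : ℝ} (hR : 0 < R) :
    ∫⁻ r in Ioo 0 R, ENNReal.ofReal (r ^ e) =
      if -1 < e then ENNReal.ofReal (R ^ (e + 1) / (e + 1)) else ⊤ := by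
  have hmeas : AEStronglyMeasurable (fun r : ℝ => r ^ e) (volume.restrict (Ioo 0 R)) :=
    (by fun_prop : Measurable fun r : ℝ => r ^ e).aestronglyMeasurable
  have hnn : 0 ≤ᵐ[volume.restrict (Ioo 0 R)] fun r : ℝ => r ^ e := by
    filter_upwards [ae_restrict_mem measurableSet_Ioo] with r hr
    exact Real.rpow_nonneg hr.1.le e
  split_ifs with h
  · have hi : IntegrableOn (fun r : ℝ => r ^ e) (Ioo 0 R) := by
      rw [← integrableOn_Ioc_iff_integrableOn_Ioo,
        ← intervalIntegrable_iff_integrableOn_Ioc_of_le hR.le]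
      exact intervalIntegral.intervalIntegrable_rpow' h
    rw [← ofReal_integral_eq_lintegral_ofReal hi hnn, ← integral_Ioc_eq_integral_Ioo,
      ← intervalIntegral.integral_of_le hR.le, integral_rpow (Or.inl h),
      Real.zero_rpow (by linarith), sub_zero]
  · by_contra hne
    have hi : IntegrableOn (fun r : ℝ => r ^ e) (Ioo 0 R) := by
      refine ⟨hmeas, ?_⟩
      rw [hasFiniteIntegral_iff_ofReal hnn]
      exact lt_top_iff_ne_top.2 hne
    exact h ((intervalIntegral.integrableOn_Ioo_rpow_iff hR).1 hi)

theorem lintegral_ball_norm_rpow {R e : ℝ} (hR : 0 < R) :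
    ∫⁻ w in Metric.ball (0 : ℂ) R, ENNReal.ofReal (‖w‖ ^ e) =
      if -2 < e then ENNReal.ofReal (2 * Real.pi / (e + 2) * R ^ (e + 2)) else ⊤ := by
  rw [lintegral_ball_radial (f := fun r => ENNReal.ofReal (r ^ e)) (by fun_prop)]
  have : ∫⁻ r in Ioo 0 R, ENNReal.ofReal r * ENNReal.ofReal (r ^ e) =
      ∫⁻ r in Ioo 0 R, ENNReal.ofReal (r ^ (e + 1)) := by
    refine setLIntegral_congr_fun measurableSet_Ioo fun r hr => ?_
    rw [← ENNReal.ofReal_mul hr.1.le, Real.rpow_add hr.1, Real.rpow_one, mul_comm]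
  rw [this, setLIntegral_Ioo_rpow hR]
  by_cases h : -2 < e
  · rw [if_pos h, if_pos (by linarith), ← ENNReal.ofReal_mul (by positivity)]
    congr 1
    rw [show e + 1 + 1 = e + 2 by ring]
    ring
  · rw [if_neg h, if_neg (by linarith), ENNReal.mul_top]
    simp [Real.pi_pos]

/-- The integral of a monomial with real exponents over a power-generalized Hartogs triangle. -/
theorem lintegral_hartogs_rpow {m n : ℕ} (hm : 0 < m) (hn : 0 < n) (d e : ℝ) :
    ∫⁻ z, ENNReal.ofReal (‖z.1‖ ^ d * ‖z.2‖ ^ e) ∂(volOn (hartogs ((m : ℝ) / n))) =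
      if -2 < d ∧ -2 < e + n / m * (d + 2) then
        ENNReal.ofReal (2 * Real.pi / (d + 2) * (2 * Real.pi / (e + n / m * (d + 2) + 2))) else ⊤ := by
  have hmeas : Measurable fun z : ℂ × ℂ => ENNReal.ofReal (‖z.1‖ ^ d * ‖z.2‖ ^ e) := by fun_prop
  rw [lintegral_hartogs hm hn hmeas]
  have hin : ∀ w : ℂ, w ∈ Metric.ball (0 : ℂ) 1 → w ≠ 0 →
      ∫⁻ z in Metric.ball (0 : ℂ) (‖w‖ ^ ((n : ℝ) / m)), ENNReal.ofReal (‖z‖ ^ d * ‖w‖ ^ e) =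
      if -2 < d then ENNReal.ofReal (2 * Real.pi / (d + 2)) *
        ENNReal.ofReal (‖w‖ ^ (e + n / m * (d + 2))) else ⊤ := by
    intro w _ hw
    have hw' : 0 < ‖w‖ := norm_pos_iff.2 hw
    have : ∀ z : ℂ, ENNReal.ofReal (‖z‖ ^ d * ‖w‖ ^ e) =
        ENNReal.ofReal (‖w‖ ^ e) * ENNReal.ofReal (‖z‖ ^ d) := fun z => by
      rw [← ENNReal.ofReal_mul (by positivity), mul_comm]
    simp_rw [this]
    rw [lintegral_const_mul _ (by fun_prop), lintegral_ball_norm_rpow (by positivity)]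
    split_ifs with h
    · have h2 : 0 < d + 2 := by linarith
      rw [← ENNReal.ofReal_mul (by positivity), ← ENNReal.ofReal_mul (by positivity)]
      congr 1
      rw [Real.rpow_add hw', Real.rpow_mul hw'.le]
      ring
    · rw [ENNReal.mul_top]
      simp only [ne_eq, ENNReal.ofReal_eq_zero, not_le]
      positivity
  have h0 : ∀ᵐ w : ℂ ∂volume.restrict (Metric.ball (0 : ℂ) 1), w ≠ 0 :=
    ae_restrict_of_ae (by simp [ae_iff, measure_singleton])
  have hcongr : ∀ᵐ w : ℂ ∂volume.restrict (Metric.ball (0 : ℂ) 1),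
      ∫⁻ z in Metric.ball (0 : ℂ) (‖w‖ ^ ((n : ℝ) / m)), ENNReal.ofReal (‖z‖ ^ d * ‖w‖ ^ e) =
      if -2 < d then ENNReal.ofReal (2 * Real.pi / (d + 2)) *
        ENNReal.ofReal (‖w‖ ^ (e + n / m * (d + 2))) else ⊤ := by
    filter_upwards [h0, ae_restrict_mem Metric.isOpen_ball.measurableSet] with w h1 h2
    exact hin w h2 h1
  rw [lintegral_congr_ae hcongr]
  by_cases hd : -2 < d
  · have h2 : 0 < d + 2 := by linarith
    simp only [hd, if_true, true_and]
    rw [lintegral_const_mul _ (by fun_prop), lintegral_ball_norm_rpow one_pos]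
    split_ifs with h
    · rw [← ENNReal.ofReal_mul (by positivity), Real.one_rpow, mul_one]
    · rw [ENNReal.mul_top]
      simp only [ne_eq, ENNReal.ofReal_eq_zero, not_le]
      positivity
  · simp only [hd, if_false, false_and]
    rw [setLIntegral_const, ENNReal.top_mul]
    exact (Metric.measure_ball_pos volume (0 : ℂ) one_pos).ne'

/-! ### Characters, rotations and averages over tori -/

theorem fourier_one_zpow (k : ℤ) (θ : UnitAddCircle) :
    (fourier 1 θ : ℂ) ^ k = fourier k θ := by
  rw [fourier_apply, fourier_apply, one_zsmul, AddCircle.toCircle_zsmul, Circle.coe_zpow]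

theorem fourier_one_ne_zero (θ : UnitAddCircle) : (fourier 1 θ : ℂ) ≠ 0 := by
  rw [fourier_apply]; exact Circle.coe_ne_zero _

theorem norm_fourier_one_mul (θ : UnitAddCircle) (w : ℂ) : ‖(fourier 1 θ : ℂ) * w‖ = ‖w‖ := by
  rw [norm_mul, fourier_apply, Circle.norm_coe, one_mul]

theorem integral_fourier (k : ℤ) :
    ∫ θ : UnitAddCircle, (fourier k θ : ℂ) = if k = 0 then 1 else 0 := by
  have h := congrFun (fourierCoeff_fourier (T := 1) k) 0
  rw [fourierCoeff, AddCircle.integral_haarAddCircle] at h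
  simp only [neg_zero, fourier_zero, one_smul, inv_one] at h
  rw [h, Pi.single_apply]
  simp [eq_comm]

/-- The phase of `w` is a translation of the circle, which Haar measure ignores. This makes the mean
value property and Cauchy's theorem on annuli available for Haar integrals. -/
theorem integral_fourier_mul_eq_circleAverage (f : ℂ → ℂ) (w : ℂ) :
    ∫ θ : UnitAddCircle, f (fourier 1 θ * w) = Real.circleAverage f 0 ‖w‖ := by
  obtain ⟨ψ, hψ⟩ : ∃ ψ : UnitAddCircle, (fourier 1 ψ : ℂ) * ‖w‖ = w := by
    refine ⟨((w.arg / (2 * Real.pi) : ℝ) : AddCircle (1 : ℝ)), ?_⟩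
    rw [fourier_coe_apply]
    conv_rhs => rw [← Complex.norm_mul_exp_arg_mul_I w]
    rw [mul_comm]
    congr 2
    push_cast
    have : (Real.pi : ℂ) ≠ 0 := by exact_mod_cast Real.pi_ne_zero
    field_simp
  have h1 : ∫ θ : UnitAddCircle, f (fourier 1 θ * w) =
      ∫ θ : UnitAddCircle, f (fourier 1 θ * ‖w‖) := by
    rw [← integral_add_right_eq_self (fun θ : UnitAddCircle => f (fourier 1 θ * ‖w‖)) ψ]
    refine integral_congr_ae (Filter.Eventually.of_forall fun θ => ?_)
    simp only
    rw [fourier_apply, fourier_apply, one_zsmul, one_zsmul, AddCircle.toCircle_add, Circle.coe_mul,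
      mul_assoc]
    rw [fourier_apply, one_zsmul] at hψ
    rw [hψ]
  rw [h1, ← UnitAddCircle.intervalIntegral_preimage 0, Real.circleAverage_def]
  have h2 : ∀ x : ℝ, f (fourier 1 (x : UnitAddCircle) * ‖w‖) =
      f (circleMap 0 ‖w‖ ((2 * Real.pi) * x)) := by
    intro x
    rw [fourier_coe_apply, circleMap, zero_add, mul_comm]
    congr 3
    push_cast
    ring
  simp_rw [h2]
  rw [intervalIntegral.integral_comp_mul_left (fun x => f (circleMap 0 ‖w‖ x)) (by positivity)]
  simp

/-- The rotation of `ℂ²` by a pair of angles. -/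
noncomputable def torusRotation (θ : UnitAddCircle × UnitAddCircle) (z : ℂ × ℂ) : ℂ × ℂ :=
  (fourier 1 θ.1 * z.1, fourier 1 θ.2 * z.2)

theorem continuous_torusRotation :
    Continuous fun q : (UnitAddCircle × UnitAddCircle) × (ℂ × ℂ) => torusRotation q.1 q.2 := by
  unfold torusRotation; fun_prop

theorem torusRotation_mem_hartogs {γ : ℝ} {θ : UnitAddCircle × UnitAddCircle} {z : ℂ × ℂ} :
    torusRotation θ z ∈ hartogs γ ↔ z ∈ hartogs γ := by
  simp only [hartogs, torusRotation, mem_ofPred_eq, norm_fourier_one_mul]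

theorem measurePreserving_fourier_one_mul (θ : UnitAddCircle) :
    MeasurePreserving (fun w : ℂ => (fourier 1 θ : ℂ) * w) := by
  have := (rotation (AddCircle.toCircle θ)).measurePreserving
  convert this using 1
  ext w
  simp [fourier_apply, rotation_apply]

theorem measurePreserving_torusRotation {n : ℕ} (hn : 0 < n) (m : ℕ)
    (θ : UnitAddCircle × UnitAddCircle) :
    MeasurePreserving (torusRotation θ) (volOn (hartogs ((m : ℝ) / n)))
      (volOn (hartogs ((m : ℝ) / n))) := by
  have h := (measurePreserving_fourier_one_mul θ.1).prod (measurePreserving_fourier_one_mul θ.2)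
  have h2 := h.restrict_preimage (isOpen_hartogs (m := m) hn).measurableSet
  have h3 : Prod.map (fun w => (fourier 1 θ.1 : ℂ) * w) (fun w => (fourier 1 θ.2 : ℂ) * w) ⁻¹'
      hartogs ((m : ℝ) / n) = hartogs ((m : ℝ) / n) :=
    Set.ext fun z => torusRotation_mem_hartogs
  rw [h3] at h2
  exact h2

instance : IsProbabilityMeasure (volume : Measure (UnitAddCircle × UnitAddCircle)) := by
  refine ⟨?_⟩
  rw [Measure.volume_eq_prod, ← univ_prod_univ, Measure.prod_prod, UnitAddCircle.measure_univ,
    one_mul]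

/-- Each rotation preserves the measure and the torus has total mass one, so averaging over all
rotations does not change an integral over the domain. -/
theorem measurePreserving_torusRotation_prod {n : ℕ} (hn : 0 < n) (m : ℕ) :
    MeasurePreserving (fun q : (UnitAddCircle × UnitAddCircle) × (ℂ × ℂ) => torusRotation q.1 q.2)
      (volume.prod (volOn (hartogs ((m : ℝ) / n)))) (volOn (hartogs ((m : ℝ) / n))) := by
  have h := (MeasurePreserving.id (volume : Measure (UnitAddCircle × UnitAddCircle))).skew_product
    (g := torusRotation) (μc := volOn (hartogs ((m : ℝ) / n))) (μd := volOn (hartogs ((m : ℝ) / n)))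
    continuous_torusRotation.measurable
    (Filter.Eventually.of_forall fun θ => (measurePreserving_torusRotation hn m θ).map_eq)
  exact measurePreserving_snd.comp h

theorem integral_torusRotation {m n : ℕ} (hn : 0 < n) {F : ℂ × ℂ → ℂ}
    (hF : Integrable F (volOn (hartogs ((m : ℝ) / n)))) :
    ∫ z, F z ∂(volOn (hartogs ((m : ℝ) / n))) =
      ∫ z, (∫ θ, F (torusRotation θ z)) ∂(volOn (hartogs ((m : ℝ) / n))) := by
  have hp := measurePreserving_torusRotation_prod hn m
  have hF' := hp.integrable_comp_of_integrable hF
  refine Eq.trans ?_ (integral_prod_symm _ hF')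
  conv_lhs => rw [← hp.map_eq]
  rw [integral_map hp.measurable.aemeasurable (by rw [hp.map_eq]; exact hF.aestronglyMeasurable)]
  rfl

theorem lintegral_torusRotation {m n : ℕ} (hn : 0 < n) {F : ℂ × ℂ → ENNReal}
    (hF : AEMeasurable F (volOn (hartogs ((m : ℝ) / n)))) :
    ∫⁻ z, F z ∂(volOn (hartogs ((m : ℝ) / n))) =
      ∫⁻ z, (∫⁻ θ, F (torusRotation θ z)) ∂(volOn (hartogs ((m : ℝ) / n))) := by
  have hp := measurePreserving_torusRotation_prod hn m
  have hF' := hF.comp_quasiMeasurePreserving hp.quasiMeasurePreserving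
  refine Eq.trans ?_ (lintegral_prod_symm _ hF')
  conv_lhs => rw [← hp.map_eq]
  rw [lintegral_map' (by rw [hp.map_eq]; exact hF) hp.measurable.aemeasurable]
  rfl

theorem lintegral_ball_rotation {F : ℂ → ENNReal} (hF : Measurable F) (R : ℝ) :
    ∫⁻ w in Metric.ball (0 : ℂ) R, F w =
      ∫⁻ w in Metric.ball (0 : ℂ) R, ∫⁻ θ : UnitAddCircle, F (fourier 1 θ * w) := by
  rw [lintegral_lintegral_swap (by
    have : Measurable fun q : ℂ × UnitAddCircle => F (fourier 1 q.2 * q.1) :=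
      hF.comp (by fun_prop)
    exact this.aemeasurable)]
  have : ∀ θ : UnitAddCircle, ∫⁻ w in Metric.ball (0 : ℂ) R, F (fourier 1 θ * w) =
      ∫⁻ w in Metric.ball (0 : ℂ) R, F w := by
    intro θ
    have h := (measurePreserving_fourier_one_mul θ).restrict_preimage
      (Metric.isOpen_ball (x := (0 : ℂ)) (ε := R)).measurableSet
    have h2 : (fun w : ℂ => (fourier 1 θ : ℂ) * w) ⁻¹' Metric.ball 0 R = Metric.ball 0 R := by
      ext w
      rw [mem_preimage, mem_ball_zero_iff, mem_ball_zero_iff, norm_fourier_one_mul]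
    rw [h2] at h
    exact h.lintegral_comp hF
  simp_rw [this]
  simp

/-! ### Schur test and Forelli–Rudin estimates on the interval and the disc -/

/-- The angular average of the modulus of the squared Cauchy kernel. -/
theorem lintegral_inv_norm_sq_one_sub {m : ℕ} (hm : 0 < m) {b : ℂ} (hb : ‖b‖ < 1) :
    ∫⁻ θ : UnitAddCircle, ENNReal.ofReal ((‖1 - b * (fourier 1 θ : ℂ) ^ m‖ ^ 2)⁻¹) =
      ENNReal.ofReal ((1 - ‖b‖ ^ 2)⁻¹) := by
  have hlt : ∀ ζ : ℂ, ‖ζ‖ ≤ 1 → ‖b * ζ ^ m‖ < 1 := by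
    intro ζ hζ
    rw [norm_mul, norm_pow]
    exact (mul_le_of_le_one_right (norm_nonneg b) (pow_le_one₀ (norm_nonneg _) hζ)).trans_lt hb
  have hne : ∀ ζ : ℂ, ‖ζ‖ ≤ 1 → 1 - b * ζ ^ m ≠ 0 := by
    intro ζ hζ h
    have := hlt ζ hζ
    rw [← sub_eq_zero.1 h] at this
    simp at this
  have hnorm : ∀ θ : UnitAddCircle, ‖(fourier 1 θ : ℂ)‖ = 1 := fun θ => by
    simpa using norm_fourier_one_mul θ 1
  -- On the unit circle the real part of `g` is the Poisson-type kernel `(1 - ‖b‖ ^ 2) / ‖1 - b * ζ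
  -- ^ m‖ ^ 2`, and the mean value property gives `g` the average `g 0 = 1`.
  set g : ℂ → ℂ := fun ζ => (1 + b * ζ ^ m) / (1 - b * ζ ^ m) with hg
  have hgd : DifferentiableOn ℂ g (Metric.closedBall 0 1) := by
    intro ζ hζ
    have h0 := hne ζ (by simpa using hζ)
    simp only [hg]
    fun_prop (disch := exact h0)
  have hgc : DiffContOnCl ℂ g (Metric.ball 0 |1|) := by
    rw [abs_one]
    exact (hgd.mono (by rw [closure_ball _ one_ne_zero])).diffContOnCl
  have h1 : ∫ θ : UnitAddCircle, g (fourier 1 θ) = 1 := by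
    have h := integral_fourier_mul_eq_circleAverage g 1
    simp only [mul_one, norm_one] at h
    rw [h, hgc.circleAverage]
    simp [hg, hm.ne']
  have hcont : Continuous fun θ : UnitAddCircle => g (fourier 1 θ) := by
    refine hgd.continuousOn.comp_continuous (by fun_prop) fun θ => ?_
    rw [mem_closedBall_zero_iff, hnorm]
  have hre : ∀ θ : UnitAddCircle, (g (fourier 1 θ)).re =
      (1 - ‖b‖ ^ 2) * (‖1 - b * (fourier 1 θ : ℂ) ^ m‖ ^ 2)⁻¹ := by
    intro θ
    have hb' : ‖b‖ ^ 2 = Complex.normSq (b * (fourier 1 θ : ℂ) ^ m) := by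
      rw [Complex.normSq_eq_norm_sq, norm_mul, norm_pow, hnorm, one_pow, mul_one]
    rw [hb', ← Complex.normSq_eq_norm_sq]
    simp only [hg]
    rw [Complex.div_re]
    have := Complex.normSq_pos.2 (hne (fourier 1 θ) (hnorm θ).le)
    field_simp
    simp [Complex.normSq_apply]
    ring
  have hpos : 0 < 1 - ‖b‖ ^ 2 := by nlinarith [norm_nonneg b]
  have h2 : ∫ θ : UnitAddCircle, (‖1 - b * (fourier 1 θ : ℂ) ^ m‖ ^ 2)⁻¹ = (1 - ‖b‖ ^ 2)⁻¹ := by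
    have h3 : (∫ θ : UnitAddCircle, (g (fourier 1 θ)).re) = 1 := by
      have := integral_re (μ := (volume : Measure UnitAddCircle)) (𝕜 := ℂ)
        (f := fun θ : UnitAddCircle => g (fourier 1 θ)) (hcont.integrable_of_hasCompactSupport
        (HasCompactSupport.of_compactSpace _))
      simp only [h1] at this
      simpa using this
    simp_rw [hre] at h3
    rw [integral_const_mul] at h3
    exact eq_inv_of_mul_eq_one_right h3
  rw [← h2, ofReal_integral_eq_lintegral_ofReal]
  · refine Continuous.integrable_of_hasCompactSupport ?_ (HasCompactSupport.of_compactSpace _)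
    refine Continuous.inv₀ (by fun_prop) fun θ => ?_
    exact pow_ne_zero _ (norm_ne_zero_iff.2 (hne _ (hnorm θ).le))
  · exact Filter.Eventually.of_forall fun θ => by positivity

/-- The Schur test with a single weight `u`. -/
theorem lintegral_rpow_le_of_schur {X : Type*} [MeasurableSpace X] {μ : Measure X} [SFinite μ]
    {k : X → X → ENNReal} (hk : Measurable (Function.uncurry k)) {u f : X → ENNReal}
    (hu : Measurable u) (hu0 : ∀ᵐ x ∂μ, u x ≠ 0) (hut : ∀ᵐ x ∂μ, u x ≠ ⊤) (hf : AEMeasurable f μ)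
    {p : ℝ} (hp : 1 < p) {C : ENNReal}
    (h₁ : ∀ᵐ z ∂μ, ∫⁻ w, k z w * u w ∂μ ≤ C * u z)
    (h₂ : ∀ᵐ w ∂μ, ∫⁻ z, k z w * u z ^ (p - 1) ∂μ ≤ C * u w ^ (p - 1)) :
    ∫⁻ z, (∫⁻ w, k z w * f w ∂μ) ^ p ∂μ ≤ C ^ p * ∫⁻ w, f w ^ p ∂μ := by
  have hp0 : 0 < p := by linarith
  have hp1 : 0 < p - 1 := by linarith
  set q : ℝ := p / (p - 1) with hq
  have hpq : q.HolderConjugate p := (Real.HolderConjugate.conjExponent hp).symm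
  have hq0 : 0 < q := hpq.pos
  have hpdq : p * (1 / q) = p - 1 := by rw [hq]; field_simp
  -- Hölder with the splitting `k f = (k u) ^ (1/q) * (k ^ (1/p) u ^ (-1/q) f)`; the exponents
  -- combine because `p / q = p - 1`.
  have key : ∀ z, (∫⁻ w, k z w * f w ∂μ) ^ p ≤
      (∫⁻ w, k z w * u w ∂μ) ^ (p - 1) * ∫⁻ w, k z w * (u w ^ (-(p - 1)) * f w ^ p) ∂μ := by
    intro z
    have hkz : Measurable (k z) := hk.comp measurable_prodMk_left
    have h := ENNReal.lintegral_mul_le_Lp_mul_Lq μ hpq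
      (f := fun w => (k z w * u w) ^ (1 / q))
      (g := fun w => k z w ^ (1 / p) * (u w ^ (-(1 / q)) * f w))
      ((hkz.mul hu).pow_const _).aemeasurable
      ((hkz.pow_const _).aemeasurable.mul ((hu.pow_const _).aemeasurable.mul hf))
    have e1 : ∫⁻ w, k z w * f w ∂μ = ∫⁻ w, ((fun w => (k z w * u w) ^ (1 / q)) *
        fun w => k z w ^ (1 / p) * (u w ^ (-(1 / q)) * f w)) w ∂μ := by
      refine lintegral_congr_ae ?_
      filter_upwards [hu0, hut] with w h0 ht
      rw [Pi.mul_apply, ENNReal.mul_rpow_of_nonneg _ _ (by positivity)]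
      have a1 : k z w ^ (1 / q) * k z w ^ (1 / p) = k z w := by
        rw [← ENNReal.rpow_add_of_nonneg _ _ (by positivity) (by positivity)]
        have : 1 / q + 1 / p = 1 := by simpa using hpq.inv_add_inv_eq_one
        rw [this, ENNReal.rpow_one]
      have a2 : u w ^ (1 / q) * u w ^ (-(1 / q)) = 1 := by
        rw [← ENNReal.rpow_add _ _ h0 ht, add_neg_cancel, ENNReal.rpow_zero]
      calc k z w * f w = (k z w ^ (1 / q) * k z w ^ (1 / p)) *
            ((u w ^ (1 / q) * u w ^ (-(1 / q))) * f w) := by rw [a1, a2, one_mul]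
        _ = _ := by ring
    rw [e1]
    refine (ENNReal.rpow_le_rpow h hp0.le).trans ?_
    rw [ENNReal.mul_rpow_of_nonneg _ _ hp0.le, ← ENNReal.rpow_mul, ← ENNReal.rpow_mul,
      one_div_mul_cancel hp0.ne', ENNReal.rpow_one, mul_comm (1 / q), hpdq]
    refine le_of_eq ?_
    congr 2
    · refine lintegral_congr fun w => ?_
      rw [← ENNReal.rpow_mul, one_div_mul_cancel hq0.ne', ENNReal.rpow_one]
    · funext w
      rw [ENNReal.mul_rpow_of_nonneg _ _ hp0.le, ENNReal.mul_rpow_of_nonneg _ _ hp0.le,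
        ← ENNReal.rpow_mul, ← ENNReal.rpow_mul, one_div_mul_cancel hp0.ne', ENNReal.rpow_one,
        neg_mul, mul_comm (1 / q), hpdq]
  have hG : AEMeasurable (fun w => u w ^ (-(p - 1)) * f w ^ p) μ :=
    (hu.pow_const _).aemeasurable.mul (hf.pow_const _)
  calc ∫⁻ z, (∫⁻ w, k z w * f w ∂μ) ^ p ∂μ
      ≤ ∫⁻ z, (C * u z) ^ (p - 1) * ∫⁻ w, k z w * (u w ^ (-(p - 1)) * f w ^ p) ∂μ ∂μ := by
        refine lintegral_mono_ae ?_
        filter_upwards [h₁] with z hz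
        exact (key z).trans (mul_le_mul_left (ENNReal.rpow_le_rpow hz hp1.le) _)
    _ = C ^ (p - 1) * ∫⁻ z, ∫⁻ w, u z ^ (p - 1) *
          (k z w * (u w ^ (-(p - 1)) * f w ^ p)) ∂μ ∂μ := by
        rw [← lintegral_const_mul'']
        · refine lintegral_congr fun z => ?_
          rw [ENNReal.mul_rpow_of_nonneg _ _ hp1.le, mul_assoc, lintegral_const_mul'']
          exact (hk.comp measurable_prodMk_left).aemeasurable.mul hG
        · have : AEMeasurable (Function.uncurry fun z w => u z ^ (p - 1) *
              (k z w * (u w ^ (-(p - 1)) * f w ^ p))) (μ.prod μ) :=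
            ((hu.comp measurable_fst).pow_const _).aemeasurable.mul
              (hk.aemeasurable.mul (hG.comp_quasiMeasurePreserving
                Measure.quasiMeasurePreserving_snd))
          exact this.lintegral_prod_right'
    _ = C ^ (p - 1) * ∫⁻ w, (u w ^ (-(p - 1)) * f w ^ p) *
          ∫⁻ z, k z w * u z ^ (p - 1) ∂μ ∂μ := by
        rw [lintegral_lintegral_swap]
        · congr 1
          refine lintegral_congr fun w => ?_
          rw [← lintegral_const_mul]
          · refine lintegral_congr fun z => ?_
            ring
          · exact (hk.comp measurable_prodMk_right).mul (hu.pow_const _)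
        · exact ((hu.comp measurable_fst).pow_const _).aemeasurable.mul
              (hk.aemeasurable.mul (hG.comp_quasiMeasurePreserving
                Measure.quasiMeasurePreserving_snd))
    _ ≤ C ^ (p - 1) * ∫⁻ w, C * f w ^ p ∂μ := by
        refine mul_le_mul_right (lintegral_mono_ae ?_) _
        filter_upwards [h₂, hu0, hut] with w hw h0 ht
        refine (mul_le_mul_right hw _).trans (le_of_eq ?_)
        have : u w ^ (-(p - 1)) * u w ^ (p - 1) = 1 := by
          rw [← ENNReal.rpow_add _ _ h0 ht, neg_add_cancel, ENNReal.rpow_zero]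
        calc u w ^ (-(p - 1)) * f w ^ p * (C * u w ^ (p - 1))
            = (u w ^ (-(p - 1)) * u w ^ (p - 1)) * (C * f w ^ p) := by ring
          _ = _ := by rw [this, one_mul]
    _ = C ^ p * ∫⁻ w, f w ^ p ∂μ := by
        rw [lintegral_const_mul'' _ (hf.pow_const _), ← mul_assoc]
        congr 1
        conv_lhs => rw [← ENNReal.rpow_one C, ← ENNReal.rpow_mul, mul_comm]
        rw [mul_comm, one_mul, ← ENNReal.rpow_add_of_nonneg _ _ hp1.le zero_le_one, sub_add_cancel]

/-- Split at `s = δ`: below it the integrand is `s ^ (-ε) / δ`, integrable at `0` since `ε < 1`;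
above it, `s ^ (-ε - 1)`, integrable at infinity since `ε > 0`. Both pieces scale like `δ ^ (-ε)`.
-/
theorem lintegral_Ioo_min_rpow_le {ε : ℝ} (h0 : 0 < ε) (h1 : ε < 1) {δ : ℝ} (hδ : 0 < δ) :
    ∫⁻ s in Ioo (0 : ℝ) 1, ENNReal.ofReal (s ^ (-ε) * (max s δ)⁻¹) ≤
      ENNReal.ofReal ((1 / (1 - ε) + 1 / ε) * δ ^ (-ε)) := by
  have hs : Ioo (0 : ℝ) 1 ⊆ Ioo 0 δ ∪ (Ioi δ ∪ {δ}) := by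
    intro s hs
    rcases lt_trichotomy s δ with h | h | h
    · exact Or.inl ⟨hs.1, h⟩
    · exact Or.inr (Or.inr h)
    · exact Or.inr (Or.inl h)
  have hε : 0 < 1 - ε := by linarith
  have i1 : ∫⁻ s in Ioo 0 δ, ENNReal.ofReal (s ^ (-ε) * (max s δ)⁻¹) =
      ENNReal.ofReal (1 / (1 - ε) * δ ^ (-ε)) := by
    have : ∫⁻ s in Ioo 0 δ, ENNReal.ofReal (s ^ (-ε) * (max s δ)⁻¹) =
        ∫⁻ s in Ioo 0 δ, ENNReal.ofReal (δ⁻¹) * ENNReal.ofReal (s ^ (-ε)) := by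
      refine setLIntegral_congr_fun measurableSet_Ioo fun s hs => ?_
      rw [max_eq_right hs.2.le, ← ENNReal.ofReal_mul (by positivity), mul_comm]
    rw [this, lintegral_const_mul _ (by fun_prop), setLIntegral_Ioo_rpow hδ,
      if_pos (by linarith), ← ENNReal.ofReal_mul (by positivity), Real.rpow_add hδ, Real.rpow_one]
    congr 1
    rw [neg_add_eq_sub]
    field_simp
  have i2 : ∫⁻ s in Ioi δ, ENNReal.ofReal (s ^ (-ε) * (max s δ)⁻¹) =
      ENNReal.ofReal (1 / ε * δ ^ (-ε)) := by
    have : ∫⁻ s in Ioi δ, ENNReal.ofReal (s ^ (-ε) * (max s δ)⁻¹) =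
        ∫⁻ s in Ioi δ, ENNReal.ofReal (s ^ (-ε - 1)) := by
      refine setLIntegral_congr_fun measurableSet_Ioi fun s hs => ?_
      have hs' : δ < s := hs
      rw [max_eq_left hs'.le, Real.rpow_sub (hδ.trans hs'), Real.rpow_one, div_eq_mul_inv]
    rw [this, ← ofReal_integral_eq_lintegral_ofReal
      (integrableOn_Ioi_rpow_of_lt (by linarith) hδ), integral_Ioi_rpow_of_lt (by linarith) hδ]
    · congr 1
      rw [sub_add_cancel]
      field_simp
    · filter_upwards [ae_restrict_mem measurableSet_Ioi] with s hs
      exact Real.rpow_nonneg (hδ.trans hs).le _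
  calc ∫⁻ s in Ioo (0 : ℝ) 1, ENNReal.ofReal (s ^ (-ε) * (max s δ)⁻¹)
      ≤ ∫⁻ s in Ioo 0 δ ∪ (Ioi δ ∪ {δ}), ENNReal.ofReal (s ^ (-ε) * (max s δ)⁻¹) :=
        lintegral_mono_set hs
    _ ≤ _ := (lintegral_union_le _ _ _).trans (add_le_add le_rfl (lintegral_union_le _ _ _))
    _ = _ := by
        rw [i1, i2, setLIntegral_measure_zero _ _ (measure_singleton δ), add_zero,
          ← ENNReal.ofReal_add (by positivity) (by positivity), add_mul]

/-- The singularities at `r = 0` and `r = 1` are handled separately. Near `1` one uses `1 - X * r ≥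
max (1 - r) (1 - X)` and substitutes `s = 1 - r`. -/
theorem lintegral_Ioo_forelliRudin {ε e : ℝ} (h0 : 0 < ε) (h1 : ε < 1) (he : -1 < e) :
    ∃ C : ℝ, 0 < C ∧ ∀ X : ℝ, 0 ≤ X → X < 1 →
      ∫⁻ r in Ioo (0 : ℝ) 1, ENNReal.ofReal (r ^ e * (1 - r) ^ (-ε) * (1 - X * r)⁻¹) ≤
        ENNReal.ofReal (C * (1 - X) ^ (-ε)) := by
  have hε : 0 < 1 - ε := by linarith
  have he' : 0 < e + 1 := by linarith
  -- For `r < 1/2`, `(1 - r) ^ (-ε) ≤ 2 ^ ε` and `(1 - X * r)⁻¹ ≤ 2`, whose product is `A`. For `r ≥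
  -- 1/2`, `r ^ e ≤ M` whatever the sign of `e`.
  set A : ℝ := 2 * 2 ^ ε with hA
  set M : ℝ := 1 + 2 ^ (-e) with hM
  refine ⟨A * (1 / (e + 1)) + M * (1 / (1 - ε) + 1 / ε), by positivity, fun X hX0 hX1 => ?_⟩
  have hδ : 0 < 1 - X := by linarith
  have hpt : ∀ r ∈ Ioo (0 : ℝ) 1, ENNReal.ofReal (r ^ e * (1 - r) ^ (-ε) * (1 - X * r)⁻¹) ≤
      ENNReal.ofReal A * ENNReal.ofReal (r ^ e) +
        ENNReal.ofReal M * ENNReal.ofReal ((1 - r) ^ (-ε) * (max (1 - r) (1 - X))⁻¹) := by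
    intro r hr
    have hr0 : 0 < r := hr.1
    have hr1 : 0 < 1 - r := by linarith [hr.2]
    have hXr : 0 < 1 - X * r := by nlinarith [hr.2]
    have hmax : max (1 - r) (1 - X) ≤ 1 - X * r :=
      max_le (by nlinarith) (by nlinarith [hr.2])
    have hmp : 0 < max (1 - r) (1 - X) := lt_max_of_lt_left hr1
    rw [← ENNReal.ofReal_mul (by positivity), ← ENNReal.ofReal_mul (by positivity),
      ← ENNReal.ofReal_add (by positivity) (by positivity)]
    refine ENNReal.ofReal_le_ofReal ?_
    by_cases h : r < 1 / 2
    · have a1 : (1 - r) ^ (-ε) ≤ 2 ^ ε := by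
        rw [Real.rpow_neg hr1.le, ← Real.inv_rpow hr1.le]
        refine Real.rpow_le_rpow (by positivity) ?_ h0.le
        rw [inv_le_comm₀ hr1 two_pos]
        linarith
      have a2 : (1 - X * r)⁻¹ ≤ 2 := by
        rw [inv_le_comm₀ hXr two_pos]
        nlinarith
      have : r ^ e * (1 - r) ^ (-ε) * (1 - X * r)⁻¹ ≤ r ^ e * 2 ^ ε * 2 := by gcongr
      refine this.trans (le_add_of_le_of_nonneg (le_of_eq (by rw [hA]; ring)) (by positivity))
    · have a1 : r ^ e ≤ M := by
        rcases le_total 0 e with h' | h'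
        · exact (Real.rpow_le_one hr0.le hr.2.le h').trans (by rw [hM]; simp; positivity)
        · have : r ^ e ≤ (1 / 2 : ℝ) ^ e :=
            Real.rpow_le_rpow_of_nonpos (by norm_num) (by linarith) h'
          rw [one_div, Real.inv_rpow two_pos.le, ← Real.rpow_neg two_pos.le] at this
          rw [hM]; linarith
      have : r ^ e * (1 - r) ^ (-ε) * (1 - X * r)⁻¹ ≤
          M * (1 - r) ^ (-ε) * (max (1 - r) (1 - X))⁻¹ := by gcongr
      refine this.trans (le_add_of_nonneg_of_le (by positivity) (le_of_eq (by ring)))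
  refine (setLIntegral_mono' measurableSet_Ioo hpt).trans ?_
  rw [lintegral_add_left (by fun_prop), lintegral_const_mul _ (by fun_prop),
    lintegral_const_mul _ (by fun_prop), setLIntegral_Ioo_rpow one_pos, if_pos he]
  have href : ∫⁻ r in Ioo (0 : ℝ) 1, ENNReal.ofReal ((1 - r) ^ (-ε) * (max (1 - r) (1 - X))⁻¹) =
      ∫⁻ s in Ioo (0 : ℝ) 1, ENNReal.ofReal (s ^ (-ε) * (max s (1 - X))⁻¹) := by
    have hmp := (Measure.measurePreserving_sub_left (volume : Measure ℝ) 1).restrict_preimage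
      (measurableSet_Ioo (a := (0 : ℝ)) (b := 1))
    have hpre : (fun r : ℝ => 1 - r) ⁻¹' Ioo 0 1 = Ioo 0 1 := by simp
    rw [hpre] at hmp
    exact hmp.lintegral_comp (f := fun s => ENNReal.ofReal (s ^ (-ε) * (max s (1 - X))⁻¹))
      (by fun_prop)
  rw [href]
  refine (add_le_add le_rfl (mul_le_mul_right (lintegral_Ioo_min_rpow_le h0 h1 hδ) _)).trans ?_
  rw [← ENNReal.ofReal_mul (by positivity), ← ENNReal.ofReal_mul (by positivity),
    ← ENNReal.ofReal_add (by positivity) (by positivity)]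
  refine ENNReal.ofReal_le_ofReal ?_
  -- This absorbs the contribution of `r` near `0`, which does not depend on `X`.
  have hge : 1 ≤ (1 - X) ^ (-ε) :=
    Real.one_le_rpow_of_pos_of_le_one_of_nonpos hδ (by linarith) (by linarith)
  rw [Real.one_rpow, add_mul (A * _), mul_assoc M]
  have : A * (1 / (e + 1)) ≤ A * (1 / (e + 1)) * (1 - X) ^ (-ε) :=
    le_mul_of_one_le_right (by positivity) hge
  linarith

/-- A Forelli–Rudin type estimate on the unit disc. -/
theorem lintegral_ball_forelliRudin {ε e : ℝ} (h0 : 0 < ε) (h1 : ε < 1) (he : -2 < e) :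
    ∃ C : ℝ, 0 < C ∧ ∀ m : ℕ, 0 < m → ∀ b : ℂ, ‖b‖ < 1 →
      ∫⁻ w in Metric.ball (0 : ℂ) 1,
        ENNReal.ofReal (‖w‖ ^ e * (1 - ‖w‖ ^ m) ^ (-ε) * (‖1 - b * w ^ m‖ ^ 2)⁻¹) ≤
        ENNReal.ofReal (C * (1 - ‖b‖) ^ (-ε)) := by
  obtain ⟨C, hC, h⟩ := lintegral_Ioo_forelliRudin h0 h1 (e := e + 1) (by linarith)
  refine ⟨2 * Real.pi * C, by positivity, fun m hm b hb => ?_⟩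
  rw [lintegral_ball_rotation (by fun_prop)]
  -- Averaging over the angle replaces `‖1 - b * w ^ m‖⁻²` by `(1 - ‖b * w ^ m‖ ^ 2)⁻¹`. Then `‖w‖ ^
  -- m ≤ ‖w‖` reduces to a radial integrand without `m`, so the constant serves all `m`.
  have hpt : ∀ w ∈ Metric.ball (0 : ℂ) 1, ∫⁻ θ : UnitAddCircle,
      ENNReal.ofReal (‖(fourier 1 θ : ℂ) * w‖ ^ e * (1 - ‖(fourier 1 θ : ℂ) * w‖ ^ m) ^ (-ε) *
        (‖1 - b * ((fourier 1 θ : ℂ) * w) ^ m‖ ^ 2)⁻¹) ≤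
      ENNReal.ofReal (‖w‖ ^ e * (1 - ‖w‖) ^ (-ε) * (1 - ‖b‖ * ‖w‖)⁻¹) := by
    intro w hw
    have hw1 : ‖w‖ < 1 := by simpa using hw
    have hwm : ‖w‖ ^ m ≤ ‖w‖ := pow_le_of_le_one (norm_nonneg _) hw1.le hm.ne'
    have hwp : 0 < 1 - ‖w‖ := by linarith
    have hwm' : 0 < 1 - ‖w‖ ^ m := by linarith
    have hbw : ‖b‖ * ‖w‖ < 1 := by nlinarith [norm_nonneg b, norm_nonneg w]
    have hbm : ‖b * w ^ m‖ ≤ ‖b‖ * ‖w‖ := by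
      rw [norm_mul, norm_pow]; gcongr
    have e1 : ∀ θ : UnitAddCircle, ENNReal.ofReal (‖(fourier 1 θ : ℂ) * w‖ ^ e *
        (1 - ‖(fourier 1 θ : ℂ) * w‖ ^ m) ^ (-ε) *
        (‖1 - b * ((fourier 1 θ : ℂ) * w) ^ m‖ ^ 2)⁻¹) =
        ENNReal.ofReal (‖w‖ ^ e * (1 - ‖w‖ ^ m) ^ (-ε)) *
          ENNReal.ofReal ((‖1 - (b * w ^ m) * (fourier 1 θ : ℂ) ^ m‖ ^ 2)⁻¹) := by
      intro θ
      rw [norm_fourier_one_mul, ← ENNReal.ofReal_mul (by positivity), mul_pow, mul_assoc b,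
        mul_comm (w ^ m)]
    simp_rw [e1]
    rw [lintegral_const_mul _ (by fun_prop), lintegral_inv_norm_sq_one_sub hm (hbm.trans_lt hbw),
      ← ENNReal.ofReal_mul (by positivity)]
    refine ENNReal.ofReal_le_ofReal ?_
    have hsq : ‖b * w ^ m‖ ^ 2 ≤ ‖b‖ * ‖w‖ := by
      nlinarith [norm_nonneg (b * w ^ m)]
    have hp : 0 < 1 - ‖b‖ * ‖w‖ := by linarith
    refine mul_le_mul (mul_le_mul_of_nonneg_left ?_ (by positivity)) ?_ (inv_nonneg.2 (by linarith))
      (by positivity)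
    · exact Real.rpow_le_rpow_of_nonpos hwp (by linarith) (by linarith)
    · exact inv_anti₀ hp (by linarith)
  refine (setLIntegral_mono' Metric.isOpen_ball.measurableSet hpt).trans ?_
  rw [lintegral_ball_radial (f := fun r => ENNReal.ofReal (r ^ e * (1 - r) ^ (-ε) *
    (1 - ‖b‖ * r)⁻¹)) (by fun_prop)]
  have e2 : ∫⁻ r in Ioo (0 : ℝ) 1, ENNReal.ofReal r *
      ENNReal.ofReal (r ^ e * (1 - r) ^ (-ε) * (1 - ‖b‖ * r)⁻¹) =
      ∫⁻ r in Ioo (0 : ℝ) 1, ENNReal.ofReal (r ^ (e + 1) * (1 - r) ^ (-ε) * (1 - ‖b‖ * r)⁻¹) := by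
    refine setLIntegral_congr_fun measurableSet_Ioo fun r hr => ?_
    rw [← ENNReal.ofReal_mul hr.1.le, Real.rpow_add hr.1, Real.rpow_one]
    congr 1
    ring
  rw [e2]
  refine (mul_le_mul_right (h ‖b‖ (norm_nonneg _) hb) _).trans ?_
  rw [← ENNReal.ofReal_mul (by positivity), mul_assoc (2 * Real.pi)]

theorem lintegral_ball_scale {F : ℂ → ENNReal} (hF : Measurable F) {R : ℝ} (hR : 0 < R) :
    ∫⁻ w in Metric.ball (0 : ℂ) R, F w =
      ENNReal.ofReal (R ^ 2) * ∫⁻ w in Metric.ball (0 : ℂ) 1, F (R * w) := by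
  have hmap := Measure.map_addHaar_smul (volume : Measure ℂ) hR.ne'
  rw [Complex.finrank_real_complex] at hmap
  have hmeas : Measurable fun w : ℂ => R • w := by fun_prop
  have e : ∫⁻ w in Metric.ball (0 : ℂ) 1, F (R * w) =
      ENNReal.ofReal (R ^ 2)⁻¹ * ∫⁻ w in Metric.ball (0 : ℂ) R, F w := by
    have hind := hF.indicator (Metric.isOpen_ball (x := (0 : ℂ)) (ε := R)).measurableSet
    rw [← lintegral_indicator Metric.isOpen_ball.measurableSet,
      ← lintegral_indicator Metric.isOpen_ball.measurableSet]
    have : ∫⁻ w : ℂ, (Metric.ball (0 : ℂ) R).indicator F w ∂(Measure.map (fun w : ℂ => R • w) volume)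
        = ∫⁻ w : ℂ, (Metric.ball (0 : ℂ) 1).indicator (fun w => F (R * w)) w := by
      rw [lintegral_map hind hmeas]
      refine lintegral_congr fun w => ?_
      have hiff : R • w ∈ Metric.ball (0 : ℂ) R ↔ w ∈ Metric.ball (0 : ℂ) 1 := by
        rw [mem_ball_zero_iff, mem_ball_zero_iff, norm_smul, Real.norm_of_nonneg hR.le]
        exact mul_lt_iff_lt_one_right hR
      by_cases hw : w ∈ Metric.ball (0 : ℂ) 1
      · rw [indicator_of_mem (hiff.2 hw), indicator_of_mem hw, Complex.real_smul]
      · rw [indicator_of_notMem (mt hiff.1 hw), indicator_of_notMem hw]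
    rw [← this, hmap, lintegral_smul_measure, abs_of_pos (by positivity), smul_eq_mul]
  rw [e, ← mul_assoc, ← ENNReal.ofReal_mul (by positivity), mul_inv_cancel₀ (by positivity),
    ENNReal.ofReal_one, one_mul]

/-! ### The positive majorant and its boundedness on `L^p` -/

/-- A positive kernel on `hartogs (m / n)` of the size of the sub-Bergman kernels. -/
noncomputable def hartogsMajorant (m n : ℕ) (κ : ℝ) (z w : ℂ × ℂ) : ℝ :=
  ‖z.2‖ ^ (-κ) * ‖w.2‖ ^ (-κ) *
    (‖1 - (z.1 * conj w.1) ^ m / (z.2 * conj w.2) ^ n‖ ^ 2)⁻¹ * (‖1 - z.2 * conj w.2‖ ^ 2)⁻¹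

/-- The test functions for the Schur test on `hartogs (m / n)`. -/
noncomputable def hartogsWeight (m n : ℕ) (β ε : ℝ) (w : ℂ × ℂ) : ℝ :=
  ‖w.2‖ ^ (-β) * (1 - ‖w.2‖) ^ (-ε) * (1 - ‖w.1‖ ^ m / ‖w.2‖ ^ n) ^ (-ε)

theorem hartogsMajorant_nonneg (m n : ℕ) (κ : ℝ) (z w : ℂ × ℂ) : 0 ≤ hartogsMajorant m n κ z w := by
  unfold hartogsMajorant; positivity

theorem hartogsMajorant_comm (m n : ℕ) (κ : ℝ) (z w : ℂ × ℂ) :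
    hartogsMajorant m n κ z w = hartogsMajorant m n κ w z := by
  have h1 : ‖1 - (z.1 * conj w.1) ^ m / (z.2 * conj w.2) ^ n‖ =
      ‖1 - (w.1 * conj z.1) ^ m / (w.2 * conj z.2) ^ n‖ := by
    rw [← RCLike.norm_conj]
    simp [mul_comm]
  have h2 : ‖1 - z.2 * conj w.2‖ = ‖1 - w.2 * conj z.2‖ := by
    rw [← RCLike.norm_conj]
    simp [mul_comm]
  rw [hartogsMajorant, hartogsMajorant, h1, h2]
  ring

theorem measurable_hartogsMajorant (m n : ℕ) (κ : ℝ) :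
    Measurable (Function.uncurry (hartogsMajorant m n κ)) := by
  unfold hartogsMajorant Function.uncurry
  have : Measurable (conj : ℂ → ℂ) := Complex.continuous_conj.measurable
  fun_prop

theorem measurable_hartogsWeight (m n : ℕ) (β ε : ℝ) : Measurable (hartogsWeight m n β ε) := by
  unfold hartogsWeight; fun_prop

theorem pow_div_pow_lt_one_of_mem_hartogs {m n : ℕ} (hn : 0 < n) {z : ℂ × ℂ}
    (hz : z ∈ hartogs ((m : ℝ) / n)) : ‖z.1‖ ^ m / ‖z.2‖ ^ n < 1 := by
  have h2 : 0 < ‖z.2‖ := norm_pos_iff.2 (snd_ne_zero_of_mem_hartogs hn hz)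
  rw [div_lt_one (by positivity)]
  exact ((mem_hartogs_iff hn).1 hz).1

theorem hartogsWeight_pos {m n : ℕ} (hn : 0 < n) (β ε : ℝ) {z : ℂ × ℂ}
    (hz : z ∈ hartogs ((m : ℝ) / n)) : 0 < hartogsWeight m n β ε z := by
  have h2 : 0 < ‖z.2‖ := norm_pos_iff.2 (snd_ne_zero_of_mem_hartogs hn hz)
  have h3 : 0 < 1 - ‖z.2‖ := sub_pos.2 ((mem_hartogs_iff hn).1 hz).2
  have h4 : 0 < 1 - ‖z.1‖ ^ m / ‖z.2‖ ^ n := sub_pos.2 (pow_div_pow_lt_one_of_mem_hartogs hn hz)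
  unfold hartogsWeight
  positivity

/-- A Forelli–Rudin type estimate on power-generalized Hartogs triangles. -/
theorem lintegral_hartogs_forelliRudin {m n : ℕ} (hm : 0 < m) (hn : 0 < n) {κ β ε : ℝ}
    (hβ : κ ≤ β) (hβκ : β + κ < 2 + 2 * n / m) (h0 : 0 < ε) (h1 : ε < 1) :
    ∃ C : ℝ, 0 < C ∧ ∀ z ∈ hartogs ((m : ℝ) / n),
      ∫⁻ w, ENNReal.ofReal (hartogsMajorant m n κ z w) * ENNReal.ofReal (hartogsWeight m n β ε w)
        ∂(volOn (hartogs ((m : ℝ) / n))) ≤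
        ENNReal.ofReal (C * hartogsWeight m n β ε z) := by
  obtain ⟨C₁, hC₁, H₁⟩ := lintegral_ball_forelliRudin h0 h1 (e := 0) (by norm_num)
  -- The exponent of `‖w.2‖` collects `-κ` from the kernel, `-β` from the weight and `2 * n / m`
  -- from the area of the slice; it exceeds `-2` by `hβκ`.
  obtain ⟨C₂, hC₂, H₂⟩ := lintegral_ball_forelliRudin h0 h1 (e := -κ - β + 2 * n / m) (by linarith)
  refine ⟨C₁ * C₂, by positivity, fun z hz => ?_⟩
  have hz2 : 0 < ‖z.2‖ := norm_pos_iff.2 (snd_ne_zero_of_mem_hartogs hn hz)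
  have hz2' : ‖z.2‖ < 1 := ((mem_hartogs_iff hn).1 hz).2
  have hX := pow_div_pow_lt_one_of_mem_hartogs hn hz
  set X : ℝ := ‖z.1‖ ^ m / ‖z.2‖ ^ n with hXdef
  have hX' : 0 < 1 - X := by linarith
  have hmeas : Measurable fun w : ℂ × ℂ => ENNReal.ofReal (hartogsMajorant m n κ z w) *
      ENNReal.ofReal (hartogsWeight m n β ε w) := by
    refine Measurable.mul ?_ (measurable_hartogsWeight m n β ε).ennreal_ofReal
    exact ((measurable_hartogsMajorant m n κ).comp measurable_prodMk_left).ennreal_ofReal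
  rw [lintegral_hartogs hm hn hmeas]
  have hin : ∀ᵐ w : ℂ ∂volume.restrict (Metric.ball (0 : ℂ) 1),
      ∫⁻ v in Metric.ball (0 : ℂ) (‖w‖ ^ ((n : ℝ) / m)),
        ENNReal.ofReal (hartogsMajorant m n κ z (v, w)) *
          ENNReal.ofReal (hartogsWeight m n β ε (v, w)) ≤
      ENNReal.ofReal (‖z.2‖ ^ (-κ) * C₁ * (1 - X) ^ (-ε)) *
        ENNReal.ofReal (‖w‖ ^ (-κ - β + 2 * n / m) * (1 - ‖w‖ ^ 1) ^ (-ε) *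
          (‖1 - conj z.2 * w ^ 1‖ ^ 2)⁻¹) := by
    have hne : ∀ᵐ w : ℂ ∂volume.restrict (Metric.ball (0 : ℂ) 1), w ≠ 0 :=
      ae_restrict_of_ae (by simp [ae_iff, measure_singleton])
    filter_upwards [hne, ae_restrict_mem Metric.isOpen_ball.measurableSet] with w hw hw1
    have hw0 : 0 < ‖w‖ := norm_pos_iff.2 hw
    have hw1' : 0 < 1 - ‖w‖ := sub_pos.2 (by simpa using hw1)
    set R : ℝ := ‖w‖ ^ ((n : ℝ) / m) with hR
    have hR0 : 0 < R := by positivity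
    have hRm : R ^ m = ‖w‖ ^ n := by
      rw [hR, ← Real.rpow_natCast, ← Real.rpow_mul (norm_nonneg _), div_mul_cancel₀ _ (by positivity),
        Real.rpow_natCast]
    -- As a function of the first variable `v`, the conjugated kernel factor is `1 - B * v ^ m`.
    -- Scaling the slice to the unit disc replaces `B` by `B * R ^ m`, of modulus exactly `X`,
    -- independent of `w`.
    set B : ℂ := conj z.1 ^ m / (conj z.2 * w) ^ n with hB
    have hBR : ‖B * (R : ℂ) ^ m‖ = X := by
      rw [hB, norm_mul, norm_div, norm_pow, norm_pow, norm_pow, norm_mul, RCLike.norm_conj,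
        RCLike.norm_conj, Complex.norm_real, Real.norm_of_nonneg hR0.le, hRm, mul_pow, hXdef]
      field_simp
    have hnum : ∀ v : ℂ, ‖1 - (z.1 * conj v) ^ m / (z.2 * conj w) ^ n‖ = ‖1 - B * v ^ m‖ := by
      intro v
      rw [← RCLike.norm_conj, hB]
      congr 1
      simp only [map_sub, map_one, map_div₀, map_pow, map_mul, Complex.conj_conj]
      rw [mul_pow, mul_div_right_comm]
    have hden : ‖1 - z.2 * conj w‖ = ‖1 - conj z.2 * w ^ 1‖ := by
      rw [← RCLike.norm_conj]
      simp
    have hpt : ∀ v ∈ Metric.ball (0 : ℂ) R,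
        ENNReal.ofReal (hartogsMajorant m n κ z (v, w)) *
          ENNReal.ofReal (hartogsWeight m n β ε (v, w)) =
        ENNReal.ofReal (‖z.2‖ ^ (-κ) * (‖w‖ ^ (-κ - β) * (1 - ‖w‖) ^ (-ε) *
          (‖1 - conj z.2 * w ^ 1‖ ^ 2)⁻¹)) *
        ENNReal.ofReal ((1 - ‖v‖ ^ m / R ^ m) ^ (-ε) * (‖1 - B * v ^ m‖ ^ 2)⁻¹) := by
      intro v _
      rw [← ENNReal.ofReal_mul (hartogsMajorant_nonneg _ _ _ _ _), ← ENNReal.ofReal_mul (by positivity)]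
      congr 1
      simp only [hartogsMajorant, hartogsWeight]
      rw [hnum, hden, hRm, sub_eq_add_neg (-κ) β, Real.rpow_add hw0]
      ring
    rw [setLIntegral_congr_fun Metric.isOpen_ball.measurableSet hpt,
      lintegral_const_mul _ (by fun_prop), lintegral_ball_scale (by fun_prop) hR0]
    have hsc : ∫⁻ v in Metric.ball (0 : ℂ) 1, ENNReal.ofReal
        ((1 - ‖(R : ℂ) * v‖ ^ m / R ^ m) ^ (-ε) * (‖1 - B * ((R : ℂ) * v) ^ m‖ ^ 2)⁻¹) ≤
        ENNReal.ofReal (C₁ * (1 - X) ^ (-ε)) := by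
      have := H₁ m hm (B * (R : ℂ) ^ m) (by rw [hBR]; exact hX)
      rw [hBR] at this
      refine le_trans (le_of_eq (lintegral_congr fun v => ?_)) this
      rw [norm_mul, Complex.norm_real, Real.norm_of_nonneg hR0.le, mul_pow, mul_pow, mul_assoc,
        mul_div_cancel_left₀ _ (by positivity), Real.rpow_zero, one_mul, mul_assoc B]
    refine (mul_le_mul_right (mul_le_mul_right hsc _) _).trans (le_of_eq ?_)
    rw [← ENNReal.ofReal_mul (by positivity), ← ENNReal.ofReal_mul (by positivity),
      ← ENNReal.ofReal_mul (by positivity)]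
    congr 1
    have hR2 : R ^ 2 = ‖w‖ ^ (2 * (n : ℝ) / m) := by
      rw [hR, ← Real.rpow_natCast, ← Real.rpow_mul (norm_nonneg _)]
      congr 1
      push_cast
      ring
    rw [hR2, Real.rpow_add hw0 (-κ - β), pow_one]
    ring_nf
  refine (lintegral_mono_ae hin).trans ?_
  rw [lintegral_const_mul _ (by fun_prop)]
  refine (mul_le_mul_right (H₂ 1 one_pos (conj z.2) (by rwa [RCLike.norm_conj])) _).trans ?_
  rw [← ENNReal.ofReal_mul (by positivity), RCLike.norm_conj]
  refine ENNReal.ofReal_le_ofReal ?_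
  have h3 : 0 < 1 - ‖z.2‖ := by linarith
  -- The integral yields only the power `-κ` of `‖z.2‖`; since `‖z.2‖ < 1` and `κ ≤ β`, it is at
  -- most the power `-β` of the weight.
  have hmono : ‖z.2‖ ^ (-κ) ≤ ‖z.2‖ ^ (-β) :=
    Real.rpow_le_rpow_of_exponent_ge hz2 hz2'.le (by linarith)
  have e : C₁ * C₂ * hartogsWeight m n β ε z =
      ‖z.2‖ ^ (-β) * C₁ * (1 - X) ^ (-ε) * (C₂ * (1 - ‖z.2‖) ^ (-ε)) := by
    unfold hartogsWeight; ring
  rw [e]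
  gcongr

/-- The positive operator with kernel `hartogsMajorant` is bounded on `L^p`. -/
theorem lintegral_hartogsMajorant_rpow_le {m n : ℕ} (hm : 0 < m) (hn : 0 < n) {κ p : ℝ}
    (hκ : 0 ≤ κ) (hp : 2 ≤ p) (hκp : κ * p < 2 + 2 * n / m) :
    ∃ C : ENNReal, C ≠ ⊤ ∧ ∀ f : ℂ × ℂ → ENNReal, AEMeasurable f (volOn (hartogs ((m : ℝ) / n))) →
      ∫⁻ z, (∫⁻ w, ENNReal.ofReal (hartogsMajorant m n κ z w) * f w
        ∂(volOn (hartogs ((m : ℝ) / n)))) ^ p ∂(volOn (hartogs ((m : ℝ) / n))) ≤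
      C * ∫⁻ w, f w ^ p ∂(volOn (hartogs ((m : ℝ) / n))) := by
  have hp0 : 0 < p := by linarith
  -- The Schur weight takes `β = κ`, the least value allowed, and `ε = 1 / p`. Its power `p - 1` is
  -- a weight of the same form, with `β = κ * (p - 1) ≥ κ` because `p ≥ 2`; there `β + κ = κ * p`,
  -- so `hκp` is exactly what is required.
  obtain ⟨C₁, hC₁, H₁⟩ := lintegral_hartogs_forelliRudin hm hn (κ := κ) (β := κ) (ε := 1 / p)
    le_rfl (by nlinarith) (by positivity) (by rw [div_lt_one hp0]; linarith)
  obtain ⟨C₂, hC₂, H₂⟩ := lintegral_hartogs_forelliRudin hm hn (κ := κ) (β := κ * (p - 1))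
    (ε := 1 / p * (p - 1)) (by nlinarith) (by nlinarith)
    (mul_pos (by positivity) (by linarith)) (by field_simp; linarith)
  have hpow : ∀ z ∈ hartogs ((m : ℝ) / n), ENNReal.ofReal (hartogsWeight m n κ (1 / p) z) ^ (p - 1) =
      ENNReal.ofReal (hartogsWeight m n (κ * (p - 1)) (1 / p * (p - 1)) z) := by
    intro z hz
    have h3 : 0 < 1 - ‖z.2‖ := sub_pos.2 ((mem_hartogs_iff hn).1 hz).2
    have h4 : 0 < 1 - ‖z.1‖ ^ m / ‖z.2‖ ^ n := sub_pos.2 (pow_div_pow_lt_one_of_mem_hartogs hn hz)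
    rw [ENNReal.ofReal_rpow_of_pos (hartogsWeight_pos hn _ _ hz)]
    congr 1
    unfold hartogsWeight
    rw [Real.mul_rpow (by positivity) (by positivity), Real.mul_rpow (by positivity) (by positivity),
      ← Real.rpow_mul (norm_nonneg _), ← Real.rpow_mul h3.le, ← Real.rpow_mul h4.le]
    simp only [neg_mul]
  have hmem : ∀ᵐ z ∂(volOn (hartogs ((m : ℝ) / n))), z ∈ hartogs ((m : ℝ) / n) :=
    ae_restrict_mem (isOpen_hartogs hn).measurableSet
  refine ⟨ENNReal.ofReal (max C₁ C₂) ^ p, ENNReal.rpow_ne_top_of_nonneg hp0.le ENNReal.ofReal_ne_top,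
    fun f hf => ?_⟩
  refine lintegral_rpow_le_of_schur (u := fun z => ENNReal.ofReal (hartogsWeight m n κ (1 / p) z))
    (measurable_hartogsMajorant m n κ).ennreal_ofReal
    (measurable_hartogsWeight m n κ (1 / p)).ennreal_ofReal ?_ ?_ hf (by linarith) ?_ ?_
  · filter_upwards [hmem] with z hz
    simpa using hartogsWeight_pos hn κ (1 / p) hz
  · exact Filter.Eventually.of_forall fun z => ENNReal.ofReal_ne_top
  · filter_upwards [hmem] with z hz
    rw [← ENNReal.ofReal_mul (by positivity)]
    refine (H₁ z hz).trans (ENNReal.ofReal_le_ofReal ?_)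
    exact mul_le_mul_of_nonneg_right (le_max_left _ _) (hartogsWeight_pos hn _ _ hz).le
  · filter_upwards [hmem] with w hw
    rw [hpow w hw, ← ENNReal.ofReal_mul (by positivity)]
    refine le_trans (le_of_eq ?_) ((H₂ w hw).trans (ENNReal.ofReal_le_ofReal
      (mul_le_mul_of_nonneg_right (le_max_right _ _) (hartogsWeight_pos hn _ _ hw).le)))
    refine lintegral_congr_ae ?_
    filter_upwards [hmem] with z hz
    rw [hpow z hz, hartogsMajorant_comm]

/-! ### The kernel: size, holomorphy and monomial expansion -/

/-- The least integer `b` with `K ≤ n * r + m * b`. -/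
def leastExponent (m n : ℕ) (K : ℤ) (r : ℕ) : ℤ := -((n * r - K) / m)

theorem leastExponent_le_iff {m n : ℕ} (hm : 0 < m) {K : ℤ} {r : ℕ} {b : ℤ} :
    leastExponent m n K r ≤ b ↔ K ≤ n * r + m * b := by
  have hm' : (0 : ℤ) < m := by exact_mod_cast hm
  rw [leastExponent, neg_le, Int.le_ediv_iff_mul_le hm']
  constructor <;> intro h <;> linarith

theorem le_leastExponent {m n : ℕ} (hm : 0 < m) (K : ℤ) (r : ℕ) :
    K ≤ n * r + m * leastExponent m n K r :=
  (leastExponent_le_iff hm).1 le_rfl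

/-- The reproducing kernel of the span of the monomials `z₁ ^ a * z₂ ^ b` with
`K ≤ n * a + m * b` in `L²(hartogs (m / n))`. -/
noncomputable def monomialKernel (m n : ℕ) (K : ℤ) (z w : ℂ × ℂ) : ℂ :=
  -- The squared norm of `z₁ ^ a * z₂ ^ b` is `π² m / ((a + 1) * (n * a + m * b + m + n))`. With `a
  -- = r + m * j` and `b = leastExponent m n K r - n * j + l` the two factors of the denominator
  -- depend on `j` alone and on `l` alone, so each `r` gives a product of two series.
  ((Real.pi : ℂ) ^ 2 * m)⁻¹ * ∑ r ∈ Finset.range m,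
    (z.1 * conj w.1) ^ r * (z.2 * conj w.2) ^ leastExponent m n K r *
    (((r : ℂ) + 1) / (1 - (z.1 * conj w.1) ^ m / (z.2 * conj w.2) ^ n) +
      m * ((z.1 * conj w.1) ^ m / (z.2 * conj w.2) ^ n) /
        (1 - (z.1 * conj w.1) ^ m / (z.2 * conj w.2) ^ n) ^ 2) *
    (((n * r + m * leastExponent m n K r + m + n : ℤ) : ℂ) / (1 - z.2 * conj w.2) +
      m * (z.2 * conj w.2) / (1 - z.2 * conj w.2) ^ 2)

theorem conj_monomialKernel (m n : ℕ) (K : ℤ) (z w : ℂ × ℂ) :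
    conj (monomialKernel m n K z w) = monomialKernel m n K w z := by
  simp only [monomialKernel, map_mul, map_sum, map_inv₀, map_pow, map_natCast, map_zpow₀, map_add,
    map_div₀, map_sub, map_one, Complex.conj_ofReal, Complex.conj_conj, map_intCast, mul_comm (w.1),
    mul_comm w.2]

theorem measurable_monomialKernel (m n : ℕ) (K : ℤ) :
    Measurable (Function.uncurry (monomialKernel m n K)) := by
  unfold monomialKernel Function.uncurry
  have : Measurable (conj : ℂ → ℂ) := Complex.continuous_conj.measurable
  have h2 : ∀ k : ℤ, Measurable fun q : (ℂ × ℂ) × (ℂ × ℂ) => (q.1.2 * conj q.2.2) ^ k := fun k =>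
    (by fun_prop : Measurable fun q : (ℂ × ℂ) × (ℂ × ℂ) => q.1.2 * conj q.2.2).pow_const k
  fun_prop

section Hartogs

variable {m n : ℕ} {z w : ℂ × ℂ}

theorem mul_conj_ne_zero_of_mem_hartogs (hn : 0 < n) (hz : z ∈ hartogs ((m : ℝ) / n))
    (hw : w ∈ hartogs ((m : ℝ) / n)) : z.2 * conj w.2 ≠ 0 :=
  mul_ne_zero (snd_ne_zero_of_mem_hartogs hn hz) (by simpa using snd_ne_zero_of_mem_hartogs hn hw)

theorem norm_mul_conj_le_of_mem_hartogs (hn : 0 < n) (hw : w ∈ hartogs ((m : ℝ) / n)) :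
    ‖z.2 * conj w.2‖ ≤ ‖z.2‖ := by
  rw [norm_mul, RCLike.norm_conj]
  exact mul_le_of_le_one_right (norm_nonneg _) ((mem_hartogs_iff hn).1 hw).2.le

theorem norm_mul_conj_lt_one_of_mem_hartogs (hn : 0 < n) (hz : z ∈ hartogs ((m : ℝ) / n))
    (hw : w ∈ hartogs ((m : ℝ) / n)) : ‖z.2 * conj w.2‖ < 1 :=
  (norm_mul_conj_le_of_mem_hartogs hn hw).trans_lt ((mem_hartogs_iff hn).1 hz).2

theorem norm_pow_div_pow_le_of_mem_hartogs (hn : 0 < n) (hw : w ∈ hartogs ((m : ℝ) / n)) :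
    ‖(z.1 * conj w.1) ^ m / (z.2 * conj w.2) ^ n‖ ≤ ‖z.1‖ ^ m / ‖z.2‖ ^ n := by
  rw [norm_div, norm_pow, norm_pow, norm_mul, norm_mul, RCLike.norm_conj, RCLike.norm_conj, mul_pow,
    mul_pow, mul_div_mul_comm]
  exact mul_le_of_le_one_right (by positivity) (pow_div_pow_lt_one_of_mem_hartogs hn hw).le

theorem norm_pow_div_pow_lt_one_of_mem_hartogs (hn : 0 < n) (hz : z ∈ hartogs ((m : ℝ) / n))
    (hw : w ∈ hartogs ((m : ℝ) / n)) : ‖(z.1 * conj w.1) ^ m / (z.2 * conj w.2) ^ n‖ < 1 :=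
  (norm_pow_div_pow_le_of_mem_hartogs hn hw).trans_lt (pow_div_pow_lt_one_of_mem_hartogs hn hz)

end Hartogs

theorem one_sub_ne_zero_of_norm_lt_one {x : ℂ} (hx : ‖x‖ < 1) : 1 - x ≠ 0 := by
  intro h
  rw [← sub_eq_zero.1 h, norm_one] at hx
  exact lt_irrefl _ hx

theorem norm_div_one_sub_add_le {x : ℂ} (hx : ‖x‖ < 1) (c : ℂ) (m : ℕ) :
    ‖c / (1 - x) + m * x / (1 - x) ^ 2‖ ≤ (2 * ‖c‖ + m) * (‖1 - x‖ ^ 2)⁻¹ := by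
  have h0 := one_sub_ne_zero_of_norm_lt_one hx
  have h2 : ‖1 - x‖ ≤ 2 := (norm_sub_le _ _).trans (by rw [norm_one]; linarith)
  have e : c / (1 - x) + m * x / (1 - x) ^ 2 = (c * (1 - x) + m * x) * ((1 - x) ^ 2)⁻¹ := by
    field_simp
  rw [e, norm_mul, norm_inv, norm_pow]
  gcongr
  refine (norm_add_le _ _).trans ?_
  rw [norm_mul, norm_mul, Complex.norm_natCast]
  have : (m : ℝ) * ‖x‖ ≤ m := mul_le_of_le_one_right (by positivity) hx.le
  nlinarith [norm_nonneg c]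

/-- Write `s = z.1 * conj w.1` and `t = z.2 * conj w.2`. On the domain `‖s‖ ≤ ‖t‖ ^ (n / m)`, so the
prefactor `s ^ r * t ^ leastExponent m n K r` is at most `‖t‖ ^ (K / m)` for every residue `r`; the
summed series have at most double poles. -/
theorem norm_monomialKernel_le {m n : ℕ} (hm : 0 < m) (hn : 0 < n) (K : ℤ) :
    ∃ C : ℝ, 0 ≤ C ∧ ∀ z ∈ hartogs ((m : ℝ) / n), ∀ w ∈ hartogs ((m : ℝ) / n),
      ‖monomialKernel m n K z w‖ ≤ C * hartogsMajorant m n (-(K : ℝ) / m) z w := by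
  refine ⟨‖((Real.pi : ℂ) ^ 2 * m)⁻¹‖ * ∑ r ∈ Finset.range m, (2 * ‖(r : ℂ) + 1‖ + m) *
    (2 * ‖((n * r + m * leastExponent m n K r + m + n : ℤ) : ℂ)‖ + m), by positivity,
    fun z hz w hw => ?_⟩
  rw [monomialKernel, norm_mul, mul_assoc]
  refine mul_le_mul_of_nonneg_left ?_ (norm_nonneg _)
  rw [Finset.sum_mul]
  refine (norm_sum_le _ _).trans (Finset.sum_le_sum fun r _ => ?_)
  have hx := norm_pow_div_pow_lt_one_of_mem_hartogs hn hz hw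
  have ht := norm_mul_conj_lt_one_of_mem_hartogs hn hz hw
  have ht0 := mul_conj_ne_zero_of_mem_hartogs hn hz hw
  have hmaj : hartogsMajorant m n (-(K : ℝ) / m) z w = ‖z.2 * conj w.2‖ ^ ((K : ℝ) / m) *
      (‖1 - (z.1 * conj w.1) ^ m / (z.2 * conj w.2) ^ n‖ ^ 2)⁻¹ *
      (‖1 - z.2 * conj w.2‖ ^ 2)⁻¹ := by
    rw [hartogsMajorant, norm_mul, RCLike.norm_conj, Real.mul_rpow (norm_nonneg _) (norm_nonneg _),
      neg_div, neg_neg]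
  rw [hmaj]
  generalize z.1 * conj w.1 = s at *
  generalize z.2 * conj w.2 = t at *
  have htp : 0 < ‖t‖ := norm_pos_iff.2 ht0
  have hs : ‖s‖ ≤ ‖t‖ ^ ((n : ℝ) / m) := by
    rw [norm_div, norm_pow, norm_pow, div_lt_one (by positivity)] at hx
    have : ‖s‖ ^ m ≤ (‖t‖ ^ ((n : ℝ) / m)) ^ m := by
      rw [← Real.rpow_natCast (‖t‖ ^ _), ← Real.rpow_mul (norm_nonneg _),
        div_mul_cancel₀ _ (by positivity), Real.rpow_natCast]
      exact hx.le
    exact (pow_le_pow_iff_left₀ (norm_nonneg _) (by positivity) hm.ne').1 this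
  have hmono : ‖s‖ ^ r * ‖t‖ ^ leastExponent m n K r ≤ ‖t‖ ^ ((K : ℝ) / m) := by
    have h1 : ‖s‖ ^ r ≤ ‖t‖ ^ ((n : ℝ) * r / m) := by
      have := pow_le_pow_left₀ (norm_nonneg _) hs r
      rwa [← Real.rpow_natCast (‖t‖ ^ _), ← Real.rpow_mul (norm_nonneg _), div_mul_eq_mul_div] at this
    calc ‖s‖ ^ r * ‖t‖ ^ leastExponent m n K r
        ≤ ‖t‖ ^ ((n : ℝ) * r / m) * ‖t‖ ^ (leastExponent m n K r : ℝ) := by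
          rw [Real.rpow_intCast]
          gcongr
      _ = ‖t‖ ^ ((n : ℝ) * r / m + leastExponent m n K r) := (Real.rpow_add htp _ _).symm
      _ ≤ _ := by
          refine Real.rpow_le_rpow_of_exponent_ge htp ht.le ?_
          have hm' : (0 : ℝ) < m := by exact_mod_cast hm
          rw [div_add' _ _ _ hm'.ne', div_le_div_iff_of_pos_right hm']
          have : (K : ℝ) ≤ n * r + m * leastExponent m n K r := by
            exact_mod_cast le_leastExponent hm K r
          linarith
  rw [norm_mul, norm_mul, norm_mul, norm_pow, norm_zpow]
  calc ‖s‖ ^ r * ‖t‖ ^ leastExponent m n K r * _ * _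
      ≤ ‖t‖ ^ ((K : ℝ) / m) * ((2 * ‖(r : ℂ) + 1‖ + m) * (‖1 - s ^ m / t ^ n‖ ^ 2)⁻¹) *
        ((2 * ‖((n * r + m * leastExponent m n K r + m + n : ℤ) : ℂ)‖ + m) * (‖1 - t‖ ^ 2)⁻¹) := by
        gcongr
        · exact norm_div_one_sub_add_le hx _ m
        · exact norm_div_one_sub_add_le ht _ m
    _ = _ := by ring

theorem DifferentiableAt.div_one_sub_add {E : Type*} [NormedAddCommGroup E] [NormedSpace ℂ E]
    {f : E → ℂ} {z : E} (hf : DifferentiableAt ℂ f z) (h : 1 - f z ≠ 0) (c : ℂ) (m : ℕ) :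
    DifferentiableAt ℂ (fun z => c / (1 - f z) + m * f z / (1 - f z) ^ 2) z := by
  have h2 : (1 - f z) ^ 2 ≠ 0 := pow_ne_zero _ h
  fun_prop (disch := assumption)

theorem differentiableOn_monomialKernel {m n : ℕ} (hn : 0 < n) (K : ℤ) {w : ℂ × ℂ}
    (hw : w ∈ hartogs ((m : ℝ) / n)) :
    DifferentiableOn ℂ (fun z => monomialKernel m n K z w) (hartogs ((m : ℝ) / n)) := by
  intro z hz
  refine DifferentiableAt.differentiableWithinAt ?_
  have ht0 := mul_conj_ne_zero_of_mem_hartogs hn hz hw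
  have htn : (z.2 * conj w.2) ^ n ≠ 0 := pow_ne_zero _ ht0
  have hx := one_sub_ne_zero_of_norm_lt_one (norm_pow_div_pow_lt_one_of_mem_hartogs hn hz hw)
  have ht := one_sub_ne_zero_of_norm_lt_one (norm_mul_conj_lt_one_of_mem_hartogs hn hz hw)
  unfold monomialKernel
  refine DifferentiableAt.const_mul (DifferentiableAt.fun_sum fun r _ => ?_) _
  have hz : DifferentiableAt ℂ (fun z : ℂ × ℂ => (z.2 * conj w.2) ^ leastExponent m n K r) z :=
    DifferentiableAt.zpow (by fun_prop) (Or.inl ht0)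
  have hxd : DifferentiableAt ℂ
      (fun z : ℂ × ℂ => (z.1 * conj w.1) ^ m / (z.2 * conj w.2) ^ n) z := by
    fun_prop (disch := assumption)
  have htd : DifferentiableAt ℂ (fun z : ℂ × ℂ => z.2 * conj w.2) z := by fun_prop
  exact (DifferentiableAt.mul (by fun_prop) hz).mul (hxd.div_one_sub_add hx _ m) |>.mul
    (htd.div_one_sub_add ht _ m)

theorem hasSum_add_mul_geometric {x : ℂ} (hx : ‖x‖ < 1) (c : ℂ) (m : ℕ) :
    HasSum (fun j : ℕ => (c + m * j) * x ^ j) (c / (1 - x) + m * x / (1 - x) ^ 2) := by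
  have h := ((hasSum_geometric_of_norm_lt_one hx).mul_left c).add
    ((hasSum_coe_mul_geometric_of_norm_lt_one hx).mul_left (m : ℂ))
  have e : (fun j : ℕ => (c + m * j) * x ^ j) = fun j : ℕ => c * x ^ j + m * (j * x ^ j) := by
    funext j; ring
  rw [e, div_eq_mul_inv c, mul_div_assoc]
  exact h

/-- The monomials occurring in the expansion of `monomialKernel`. -/
noncomputable def kernelMonomial (m n : ℕ) (a b : ℤ) (z w : ℂ × ℂ) : ℂ :=
  ((Real.pi : ℂ) ^ 2 * m)⁻¹ * (((a + 1 : ℤ) : ℂ) * ((n * a + m * b + m + n : ℤ) : ℂ)) *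
    ((z.1 * conj w.1) ^ a * (z.2 * conj w.2) ^ b)

/-- Passing from `(a, b)` to `(a + m, b - n)` leaves `n * a + m * b` fixed. Thus `j` enters only
through `a + 1` and `l` only through the other factor, which separates the double series. -/
theorem kernelMonomial_shift (m n : ℕ) (K : ℤ) (r j l : ℕ) {z w : ℂ × ℂ}
    (ht0 : z.2 * conj w.2 ≠ 0) :
    kernelMonomial m n (r + m * j) (leastExponent m n K r - n * j + l) z w =
      ((Real.pi : ℂ) ^ 2 * m)⁻¹ *
        ((z.1 * conj w.1) ^ r * (z.2 * conj w.2) ^ leastExponent m n K r) *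
      ((((r : ℂ) + 1) + m * j) * ((z.1 * conj w.1) ^ m / (z.2 * conj w.2) ^ n) ^ j *
        ((((n * r + m * leastExponent m n K r + m + n : ℤ) : ℂ) + m * l) *
          (z.2 * conj w.2) ^ l)) := by
  unfold kernelMonomial
  generalize z.1 * conj w.1 = s
  generalize z.2 * conj w.2 = t at *
  have e1 : s ^ ((r : ℤ) + m * j) = s ^ r * (s ^ m) ^ j := by
    rw [← pow_mul, ← pow_add]
    exact_mod_cast zpow_natCast s (r + m * j)
  have e2 : t ^ (leastExponent m n K r - n * j + l) =
      t ^ leastExponent m n K r * ((t ^ n) ^ j)⁻¹ * t ^ l := by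
    rw [zpow_add₀ ht0, zpow_sub₀ ht0, zpow_mul, zpow_natCast, zpow_natCast, zpow_natCast,
      div_eq_mul_inv]
  rw [e1, e2, div_pow, div_eq_mul_inv ((s ^ m) ^ j)]
  push_cast
  ring

theorem HasSum.mul_prod {f g : ℕ → ℂ} {a b : ℂ} (hf : HasSum f a) (hg : HasSum g b) :
    HasSum (fun q : ℕ × ℕ => f q.1 * g q.2) (a * b) :=
  hf.mul hg (summable_mul_of_summable_norm hf.summable.norm hg.summable.norm)

theorem hasSum_kernelMonomial {m n : ℕ} (hn : 0 < n) (K : ℤ) {z w : ℂ × ℂ}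
    (hz : z ∈ hartogs ((m : ℝ) / n)) (hw : w ∈ hartogs ((m : ℝ) / n)) (r : ℕ) :
    HasSum (fun q : ℕ × ℕ => kernelMonomial m n (r + m * q.1)
        (leastExponent m n K r - n * q.1 + q.2) z w)
      (((Real.pi : ℂ) ^ 2 * m)⁻¹ *
        ((z.1 * conj w.1) ^ r * (z.2 * conj w.2) ^ leastExponent m n K r) *
      ((((r : ℂ) + 1) / (1 - (z.1 * conj w.1) ^ m / (z.2 * conj w.2) ^ n) +
        m * ((z.1 * conj w.1) ^ m / (z.2 * conj w.2) ^ n) /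
          (1 - (z.1 * conj w.1) ^ m / (z.2 * conj w.2) ^ n) ^ 2) *
      (((n * r + m * leastExponent m n K r + m + n : ℤ) : ℂ) / (1 - z.2 * conj w.2) +
        m * (z.2 * conj w.2) / (1 - z.2 * conj w.2) ^ 2))) := by
  have hx := norm_pow_div_pow_lt_one_of_mem_hartogs hn hz hw
  have ht := norm_mul_conj_lt_one_of_mem_hartogs hn hz hw
  have ht0 := mul_conj_ne_zero_of_mem_hartogs hn hz hw
  have h1 := hasSum_add_mul_geometric hx ((r : ℂ) + 1) m
  have h2 := hasSum_add_mul_geometric ht ((n * r + m * leastExponent m n K r + m + n : ℤ) : ℂ) m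
  refine ((h1.mul_prod h2).mul_left _).congr_fun fun q => ?_
  exact kernelMonomial_shift m n K r q.1 q.2 ht0

/-! ### Fourier coefficients of the kernel on tori -/

/-- The Fourier coefficients of a function on the torus through `z`. -/
noncomputable def torusCoeff (a b : ℤ) (F : ℂ × ℂ → ℂ) (z : ℂ × ℂ) : ℂ :=
  ∫ θ : UnitAddCircle × UnitAddCircle,
    fourier (-a) θ.1 * fourier (-b) θ.2 * F (torusRotation θ z)

theorem norm_fourier_mul_fourier (a b : ℤ) (θ : UnitAddCircle × UnitAddCircle) :
    ‖(fourier a θ.1 : ℂ) * fourier b θ.2‖ = 1 := by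
  rw [norm_mul, fourier_apply, fourier_apply, Circle.norm_coe, Circle.norm_coe, one_mul]

theorem integral_fourier_mul_fourier (a b a' b' : ℤ) :
    ∫ θ : UnitAddCircle × UnitAddCircle, (fourier (-a) θ.1 * fourier (-b) θ.2 *
      (fourier a' θ.1 * fourier b' θ.2) : ℂ) = if a' = a ∧ b' = b then 1 else 0 := by
  have e : ∀ θ : UnitAddCircle × UnitAddCircle, (fourier (-a) θ.1 * fourier (-b) θ.2 *
      (fourier a' θ.1 * fourier b' θ.2) : ℂ) = fourier (-a + a') θ.1 * fourier (-b + b') θ.2 := by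
    intro θ
    rw [fourier_add, fourier_add]
    ring
  simp_rw [e]
  rw [Measure.volume_eq_prod, integral_prod_mul (fun θ : UnitAddCircle => (fourier (-a + a') θ : ℂ))
    (fun θ : UnitAddCircle => (fourier (-b + b') θ : ℂ)), integral_fourier, integral_fourier]
  have h1 : -a + a' = 0 ↔ a' = a := by omega
  have h2 : -b + b' = 0 ↔ b' = b := by omega
  simp only [h1, h2]
  split_ifs <;> simp_all

theorem kernelMonomial_torusRotation (m n : ℕ) (a b : ℤ) (θ : UnitAddCircle × UnitAddCircle)
    (z w : ℂ × ℂ) : kernelMonomial m n a b (torusRotation θ z) w =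
      fourier a θ.1 * fourier b θ.2 * kernelMonomial m n a b z w := by
  unfold kernelMonomial torusRotation
  simp only [mul_assoc (fourier 1 _ : ℂ)]
  rw [mul_zpow, mul_zpow (fourier 1 θ.2 : ℂ), fourier_one_zpow, fourier_one_zpow]
  ring

theorem torusCoeff_kernelMonomial (m n : ℕ) (a b a' b' : ℤ) (z w : ℂ × ℂ) :
    torusCoeff a b (fun z => kernelMonomial m n a' b' z w) z =
      if a' = a ∧ b' = b then kernelMonomial m n a b z w else 0 := by
  unfold torusCoeff
  simp_rw [kernelMonomial_torusRotation, ← mul_assoc]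
  rw [integral_mul_const]
  have := integral_fourier_mul_fourier a b a' b'
  simp_rw [← mul_assoc] at this
  rw [this]
  split_ifs with h
  · rw [h.1, h.2, one_mul]
  · rw [zero_mul]

/-- Admissible pairs `(a, b)` correspond bijectively to triples `(r, j, l)` with `r = a % m`, `j = a
/ m` and `l = b + n * j - leastExponent m n K r`. Hence at most one term of the family survives, and
only for the right residue. -/
theorem hasSum_torusCoeff_kernelMonomial {m n : ℕ} (hm : 0 < m) (K : ℤ) (a b : ℤ) (z w : ℂ × ℂ)
    (r : ℕ) (hr : r < m) :
    HasSum (fun q : ℕ × ℕ => torusCoeff a b (fun z => kernelMonomial m n (r + m * q.1)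
        (leastExponent m n K r - n * q.1 + q.2) z w) z)
      (if r = (a % m).toNat then
        (if 0 ≤ a ∧ K ≤ n * a + m * b then kernelMonomial m n a b z w else 0) else 0) := by
  have hm' : (0 : ℤ) < m := by exact_mod_cast hm
  have hmod := Int.emod_nonneg a hm'.ne'
  have hdm := Int.emod_add_mul_ediv a m
  simp_rw [torusCoeff_kernelMonomial]
  have hzero : (¬ (r = (a % m).toNat ∧ 0 ≤ a ∧ K ≤ n * a + m * b)) → ∀ q : ℕ × ℕ,
      ¬ ((r : ℤ) + m * q.1 = a ∧ leastExponent m n K r - n * q.1 + q.2 = b) := by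
    rintro h q ⟨h1, h2⟩
    refine h ⟨?_, ?_, ?_⟩
    · have : a % m = r := by
        rw [← h1, Int.add_mul_emod_self_left]
        exact Int.emod_eq_of_lt (by positivity) (by exact_mod_cast hr)
      rw [this]; rfl
    · rw [← h1]; positivity
    · have := le_leastExponent (n := n) hm K r
      rw [← h1, ← h2]
      have h3 : (0 : ℤ) ≤ m * q.2 := by positivity
      nlinarith
  by_cases h : r = (a % m).toNat ∧ 0 ≤ a ∧ K ≤ n * a + m * b
  · rw [if_pos h.1, if_pos h.2]
    have hr' : (r : ℤ) = a % m := by rw [h.1]; exact Int.toNat_of_nonneg hmod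
    have hdiv : 0 ≤ a / m := Int.ediv_nonneg h.2.1 hm'.le
    have hb : leastExponent m n K r ≤ b + n * (a / m) := by
      rw [leastExponent_le_iff hm, hr']
      have h3 : n * (a % m) + m * (b + n * (a / m)) = n * (a % m + m * (a / m)) + m * b := by ring
      rw [h3, hdm]
      exact h.2.2
    set q₀ : ℕ × ℕ := ((a / m).toNat, (b + n * (a / m) - leastExponent m n K r).toNat) with hq₀
    have hq1 : ((q₀.1 : ℕ) : ℤ) = a / m := Int.toNat_of_nonneg hdiv
    have hq2 : ((q₀.2 : ℕ) : ℤ) = b + n * (a / m) - leastExponent m n K r :=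
      Int.toNat_of_nonneg (by linarith)
    have h0 : (r : ℤ) + m * q₀.1 = a ∧ leastExponent m n K r - n * q₀.1 + q₀.2 = b := by
      rw [hq1, hq2, hr']
      exact ⟨hdm, by ring⟩
    have hs := hasSum_single (f := fun q : ℕ × ℕ => if (r : ℤ) + m * q.1 = a ∧
      leastExponent m n K r - n * q.1 + q.2 = b then kernelMonomial m n a b z w else 0) q₀ (by
      intro q hq
      refine if_neg fun hq' => hq ?_
      have h4 : (m : ℤ) * q.1 = m * q₀.1 := by linarith [hq'.1, h0.1]
      have h5 : (q.1 : ℤ) = q₀.1 := mul_left_cancel₀ hm'.ne' h4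
      have h6 : (q.2 : ℤ) = q₀.2 := by
        have := hq'.2; have := h0.2; rw [h5] at *; linarith
      exact Prod.ext (by exact_mod_cast h5) (by exact_mod_cast h6))
    simp only [if_pos h0] at hs
    exact hs
  · have : (if r = (a % m).toNat then
        (if 0 ≤ a ∧ K ≤ n * a + m * b then kernelMonomial m n a b z w else 0) else 0) = 0 := by
      split_ifs with h1 h2
      · exact absurd ⟨h1, h2⟩ h
      · rfl
      · rfl
    rw [this]
    have hz := hzero h
    simp only [hz, if_false]
    exact hasSum_zero

/-- The Fourier expansion of `monomialKernel` on tori. -/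
theorem torusCoeff_monomialKernel {m n : ℕ} (hm : 0 < m) (hn : 0 < n) (K : ℤ) (a b : ℤ)
    {z w : ℂ × ℂ} (hz : z ∈ hartogs ((m : ℝ) / n)) (hw : w ∈ hartogs ((m : ℝ) / n)) :
    torusCoeff a b (fun z => monomialKernel m n K z w) z =
      if 0 ≤ a ∧ K ≤ n * a + m * b then kernelMonomial m n a b z w else 0 := by
  have hm' : (0 : ℤ) < m := by exact_mod_cast hm
  have hrot : ∀ θ, torusRotation θ z ∈ hartogs ((m : ℝ) / n) := fun θ =>
    torusRotation_mem_hartogs.2 hz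
  set F : ℕ → ℕ × ℕ → UnitAddCircle × UnitAddCircle → ℂ := fun r q θ =>
    fourier (-a) θ.1 * fourier (-b) θ.2 * kernelMonomial m n (r + m * q.1)
        (leastExponent m n K r - n * q.1 + q.2) (torusRotation θ z) w with hF
  have hFcont : ∀ r q, Continuous (F r q) := by
    intro r q
    simp only [hF, kernelMonomial_torusRotation]
    fun_prop
  have hFint : ∀ r q, Integrable (F r q) := fun r q =>
    (hFcont r q).integrable_of_hasCompactSupport (HasCompactSupport.of_compactSpace _)
  have hFnorm : ∀ r q θ, ‖F r q θ‖ = ‖kernelMonomial m n (r + m * q.1)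
        (leastExponent m n K r - n * q.1 + q.2) z w‖ := by
    intro r q θ
    simp only [hF]
    rw [kernelMonomial_torusRotation, norm_mul, norm_mul _ (kernelMonomial _ _ _ _ _ _),
      norm_fourier_mul_fourier, norm_fourier_mul_fourier, one_mul, one_mul]
  -- Rotation does not change the modulus of a monomial, so absolute convergence at `z` alone
  -- dominates the series on the whole torus.
  have hFsum : ∀ r, Summable fun q => ∫ θ, ‖F r q θ‖ := by
    intro r
    simp_rw [hFnorm]
    simp only [integral_const, probReal_univ, one_smul]
    exact (hasSum_kernelMonomial hn K hz hw r).summable.norm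
  have hkey : ∀ r ∈ Finset.range m, ∫ θ, ∑' q, F r q θ = if r = (a % m).toNat then
        (if 0 ≤ a ∧ K ≤ n * a + m * b then kernelMonomial m n a b z w else 0) else 0 := by
    intro r hr
    exact (hasSum_integral_of_summable_integral_norm (hFint r) (hFsum r)).unique
      (hasSum_torusCoeff_kernelMonomial hm K a b z w r (Finset.mem_range.1 hr))
  have hexp : ∀ θ, fourier (-a) θ.1 * fourier (-b) θ.2 * monomialKernel m n K (torusRotation θ z) w =
      ∑ r ∈ Finset.range m, ∑' q, F r q θ := by
    intro θ
    rw [monomialKernel, Finset.mul_sum, Finset.mul_sum]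
    refine Finset.sum_congr rfl fun r _ => ?_
    have h := (hasSum_kernelMonomial hn K (hrot θ) hw r).mul_left
      ((fourier (-a) θ.1 : ℂ) * fourier (-b) θ.2)
    rw [h.tsum_eq]
    ring
  have hsumint : ∀ r ∈ Finset.range m, Integrable fun θ => ∑' q, F r q θ := by
    intro r _
    have : Continuous fun θ => ∑' q, F r q θ :=
      continuous_tsum (hFcont r) (hasSum_kernelMonomial hn K hz hw r).summable.norm
        fun q θ => (hFnorm r q θ).le
    exact this.integrable_of_hasCompactSupport (HasCompactSupport.of_compactSpace _)
  rw [torusCoeff]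
  simp_rw [hexp]
  rw [integral_finsetSum _ hsumint, Finset.sum_congr rfl hkey, Finset.sum_ite_eq',
    if_pos]
  rw [Finset.mem_range, Int.toNat_lt (Int.emod_nonneg a hm'.ne')]
  exact Int.emod_lt_of_pos a hm'

/-! ### The integral operator: holomorphy, `L^p` bound and symmetry -/

/-- Integrals depending holomorphically on a parameter in `ℂ²`. -/
theorem differentiableOn_integral_of_locally_dominated {X : Type*} [MeasurableSpace X]
    {μ : Measure X} {U : Set (ℂ × ℂ)} (hU : IsOpen U) {F : ℂ × ℂ → X → ℂ}
    (hF : ∀ z ∈ U, AEStronglyMeasurable (F z) μ)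
    (hd : ∀ᵐ w ∂μ, DifferentiableOn ℂ (fun z => F z w) U)
    (hb : ∀ z₀ ∈ U, ∃ V ∈ nhds z₀, ∃ bound : X → ℝ, Integrable bound μ ∧
      ∀ᵐ w ∂μ, ∀ z ∈ V, ‖F z w‖ ≤ bound w) :
    DifferentiableOn ℂ (fun z => ∫ w, F z w ∂μ) U := by
  intro z₀ hz₀
  obtain ⟨V, hV, bound, hbi, hbV⟩ := hb z₀ hz₀
  obtain ⟨ε, hε, hball⟩ := Metric.mem_nhds_iff.1 (Filter.inter_mem hV (hU.mem_nhds hz₀))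
  have hz₀b : z₀ ∈ Metric.ball z₀ ε := Metric.mem_ball_self hε
  have hder : ∀ᵐ w ∂μ, HasFDerivAt (fun z => F z w) (fderiv ℂ (fun z => F z w) z₀) z₀ := by
    filter_upwards [hd] with w hw
    exact (hw.differentiableAt (hU.mem_nhds hz₀)).hasFDerivAt
  -- Directional derivatives are limits of difference quotients along the steps `v / k`; dropping
  -- the first `N` indices keeps the evaluation points in `U`.
  have hdir : ∀ v : ℂ × ℂ, AEStronglyMeasurable (fun w => fderiv ℂ (fun z => F z w) z₀ v) μ := by
    intro v
    have hc : Filter.Tendsto (fun k : ℕ => ‖((k : ℂ))‖) Filter.atTop Filter.atTop := by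
      simpa using tendsto_natCast_atTop_atTop (R := ℝ)
    have hin : ∀ᶠ k : ℕ in Filter.atTop, z₀ + ((k : ℂ))⁻¹ • v ∈ U := by
      have h1 : Filter.Tendsto (fun k : ℕ => z₀ + ((k : ℂ))⁻¹ • v) Filter.atTop (nhds z₀) := by
        have h2 : Filter.Tendsto (fun k : ℕ => ((k : ℂ))⁻¹) Filter.atTop (nhds 0) :=
          tendsto_inv_atTop_nhds_zero_nat
        simpa using (h2.smul_const v).const_add z₀
      exact h1 (hU.mem_nhds hz₀)
    obtain ⟨N, hN⟩ := Filter.eventually_atTop.1 hin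
    refine aestronglyMeasurable_of_tendsto_ae (Filter.atTop : Filter ℕ)
      (f := fun k w => ((k + N : ℕ) : ℂ) • (F (z₀ + (((k + N : ℕ) : ℂ))⁻¹ • v) w - F z₀ w)) ?_ ?_
    · exact fun k => ((hF _ (hN _ (Nat.le_add_left N k))).sub (hF _ hz₀)).const_smul ((k + N : ℕ) : ℂ)
    · filter_upwards [hder] with w hw
      exact (hw.lim v hc).comp (Filter.tendsto_add_atTop_nat N)
  have hF' : AEStronglyMeasurable (fun w => fderiv ℂ (fun z => F z w) z₀) μ := by
    have e : ∀ L : ℂ × ℂ →L[ℂ] ℂ, L = L (1, 0) • ContinuousLinearMap.fst ℂ ℂ ℂ +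
        L (0, 1) • ContinuousLinearMap.snd ℂ ℂ ℂ := by
      intro L
      ext <;> simp
    rw [funext fun w => e (fderiv ℂ (fun z => F z w) z₀)]
    exact ((hdir _).smul_const _).add ((hdir _).smul_const _)
  have hint : Integrable (F z₀) μ := by
    refine hbi.mono' (hF z₀ hz₀) ?_
    filter_upwards [hbV] with w hw
    exact hw z₀ (hball hz₀b).1
  refine (hasFDerivAt_integral_of_dominated_loc_of_lip' (bound := fun w => 2 * bound w / ε)
    (Metric.ball_mem_nhds z₀ hε) (fun z hz => hF z (hball hz).2) hint hF' ?_
    ((hbi.const_mul 2).div_const ε) hder).2.differentiableAt.differentiableWithinAt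
  filter_upwards [hd, hbV] with w hw hbw z hz
  -- By the Schwarz lemma a bound on the values gives a Lipschitz bound at the centre, so no
  -- domination of the derivative has to be assumed.
  have h := Complex.dist_le_div_mul_dist_of_mapsTo_ball (f := fun z => F z w) (R₂ := 2 * bound w)
    (hw.mono fun x hx => (hball hx).2) (fun x hx => ?_) hz
  · simpa [dist_eq_norm] using h
  · rw [mem_closedBall_iff_norm]
    refine (norm_sub_le _ _).trans ?_
    linarith [hbw x (hball hx).1, hbw z₀ (hball hz₀b).1]

/-- The integral operator with kernel `monomialKernel`. -/
noncomputable def monomialProjection (m n : ℕ) (K : ℤ) (g : ℂ × ℂ → ℂ) (z : ℂ × ℂ) : ℂ :=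
  ∫ w, monomialKernel m n K z w * g w ∂(volOn (hartogs ((m : ℝ) / n)))

theorem isFiniteMeasure_volOn_hartogs {m n : ℕ} (hm : 0 < m) (hn : 0 < n) :
    IsFiniteMeasure (volOn (hartogs ((m : ℝ) / n))) :=
  isFiniteMeasure_restrict.2 (volume_hartogs_lt_top (by positivity)).ne

theorem ae_mem_hartogs {m n : ℕ} (hn : 0 < n) :
    ∀ᵐ z ∂(volOn (hartogs ((m : ℝ) / n))), z ∈ hartogs ((m : ℝ) / n) :=
  ae_restrict_mem (isOpen_hartogs hn).measurableSet

/-- Separates the variables: the factor in `z` is continuous on the domain and depends only on the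
moduli of its coordinates. This gives local domination for holomorphy and uniform domination on
tori. -/
theorem hartogsMajorant_le {m n : ℕ} (hn : 0 < n) (κ : ℝ) {z w : ℂ × ℂ}
    (hz : z ∈ hartogs ((m : ℝ) / n)) (hw : w ∈ hartogs ((m : ℝ) / n)) :
    hartogsMajorant m n κ z w ≤
      (‖z.2‖ ^ (-κ) * ((1 - ‖z.1‖ ^ m / ‖z.2‖ ^ n) ^ 2)⁻¹ * ((1 - ‖z.2‖) ^ 2)⁻¹) *
        ‖w.2‖ ^ (-κ) := by
  have h3 : 0 < 1 - ‖z.2‖ := sub_pos.2 ((mem_hartogs_iff hn).1 hz).2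
  have h4 : 0 < 1 - ‖z.1‖ ^ m / ‖z.2‖ ^ n := sub_pos.2 (pow_div_pow_lt_one_of_mem_hartogs hn hz)
  have hsub : ∀ x : ℂ, 1 - ‖x‖ ≤ ‖1 - x‖ := fun x => by
    simpa using norm_sub_norm_le (1 : ℂ) x
  have h5 : 1 - ‖z.1‖ ^ m / ‖z.2‖ ^ n ≤ ‖1 - (z.1 * conj w.1) ^ m / (z.2 * conj w.2) ^ n‖ :=
    le_trans (by linarith [norm_pow_div_pow_le_of_mem_hartogs (z := z) hn hw]) (hsub _)
  have h6 : 1 - ‖z.2‖ ≤ ‖1 - z.2 * conj w.2‖ :=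
    le_trans (by linarith [norm_mul_conj_le_of_mem_hartogs (z := z) hn hw]) (hsub _)
  calc hartogsMajorant m n κ z w
      ≤ ‖z.2‖ ^ (-κ) * ‖w.2‖ ^ (-κ) * ((1 - ‖z.1‖ ^ m / ‖z.2‖ ^ n) ^ 2)⁻¹ *
        ((1 - ‖z.2‖) ^ 2)⁻¹ := by
        unfold hartogsMajorant
        gcongr
    _ = _ := by ring

/-- Cauchy–Schwarz: `hκ` places `‖w.2‖ ^ (-κ)` in `L²`. -/
theorem integrable_norm_rpow_mul {m n : ℕ} (hm : 0 < m) (hn : 0 < n) {κ : ℝ}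
    (hκ : κ * 2 < 2 + 2 * n / m) {g : ℂ × ℂ → ℂ} (hg : MemLp g 2 (volOn (hartogs ((m : ℝ) / n)))) :
    Integrable (fun w : ℂ × ℂ => ‖w.2‖ ^ (-κ) * ‖g w‖) (volOn (hartogs ((m : ℝ) / n))) := by
  have h1 : MemLp (fun w : ℂ × ℂ => ‖w.2‖ ^ (-κ)) 2 (volOn (hartogs ((m : ℝ) / n))) := by
    have hmeas : Measurable fun w : ℂ × ℂ => ‖w.2‖ ^ (-κ) := by fun_prop
    refine ⟨hmeas.aestronglyMeasurable, ?_⟩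
    rw [eLpNorm_lt_top_iff_lintegral_rpow_enorm_lt_top two_ne_zero ENNReal.ofNat_ne_top]
    have e : ∀ w : ℂ × ℂ, ‖‖w.2‖ ^ (-κ)‖ₑ ^ (2 : ENNReal).toReal =
        ENNReal.ofReal (‖w.1‖ ^ (0 : ℝ) * ‖w.2‖ ^ (-κ * 2)) := by
      intro w
      rw [Real.enorm_of_nonneg (by positivity), ENNReal.toReal_ofNat,
        ENNReal.ofReal_rpow_of_nonneg (by positivity) (by norm_num), ← Real.rpow_mul (norm_nonneg _),
        Real.rpow_zero, one_mul]
    simp_rw [e]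
    have h2 : 2 * (n : ℝ) / m = n / m * (0 + 2) := by ring
    rw [lintegral_hartogs_rpow hm hn, if_pos ⟨by norm_num, by rw [← h2]; linarith⟩]
    exact ENNReal.ofReal_lt_top
  exact h1.integrable_mul hg.norm

theorem differentiableOn_monomialProjection {m n : ℕ} (hm : 0 < m) (hn : 0 < n) {K : ℤ}
    (hK : -(K : ℝ) / m * 2 < 2 + 2 * n / m) {g : ℂ × ℂ → ℂ}
    (hg : MemLp g 2 (volOn (hartogs ((m : ℝ) / n)))) :
    DifferentiableOn ℂ (monomialProjection m n K g) (hartogs ((m : ℝ) / n)) := by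
  obtain ⟨C, hC, hbound⟩ := norm_monomialKernel_le hm hn K
  have hopen : IsOpen (hartogs ((m : ℝ) / n)) := isOpen_hartogs hn
  refine differentiableOn_integral_of_locally_dominated hopen ?_ ?_ ?_
  · intro z _
    exact ((measurable_monomialKernel m n K).comp measurable_prodMk_left).aestronglyMeasurable.mul
      hg.aestronglyMeasurable
  · filter_upwards [ae_mem_hartogs hn] with w hw
    exact (differentiableOn_monomialKernel hn K hw).mul_const _
  · intro z₀ hz₀
    set M : ℂ × ℂ → ℝ := fun z => ‖z.2‖ ^ (-(-(K : ℝ) / m)) *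
      ((1 - ‖z.1‖ ^ m / ‖z.2‖ ^ n) ^ 2)⁻¹ * ((1 - ‖z.2‖) ^ 2)⁻¹ with hM
    have h2 : ‖z₀.2‖ ≠ 0 := norm_ne_zero_iff.2 (snd_ne_zero_of_mem_hartogs hn hz₀)
    have h2n : ‖z₀.2‖ ^ n ≠ 0 := pow_ne_zero _ h2
    have h3 : (1 - ‖z₀.2‖) ^ 2 ≠ 0 := pow_ne_zero _ (sub_pos.2 ((mem_hartogs_iff hn).1 hz₀).2).ne'
    have h4 : (1 - ‖z₀.1‖ ^ m / ‖z₀.2‖ ^ n) ^ 2 ≠ 0 :=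
      pow_ne_zero _ (sub_pos.2 (pow_div_pow_lt_one_of_mem_hartogs hn hz₀)).ne'
    have hMc : ContinuousAt M z₀ := by
      refine ContinuousAt.mul (ContinuousAt.mul ?_ (ContinuousAt.inv₀ ?_ h4))
        (ContinuousAt.inv₀ (by fun_prop) h3)
      · exact ContinuousAt.rpow_const (by fun_prop) (Or.inl h2)
      · have : ContinuousAt (fun z : ℂ × ℂ => ‖z.1‖ ^ m / ‖z.2‖ ^ n) z₀ :=
          ContinuousAt.div (by fun_prop) (by fun_prop) h2n
        fun_prop
    have hev : ∀ᶠ z in nhds z₀, M z < M z₀ + 1 := hMc.eventually_lt_const (lt_add_one _)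
    refine ⟨_, Filter.inter_mem hev (hopen.mem_nhds hz₀),
      fun w => C * (M z₀ + 1) * (‖w.2‖ ^ (-(-(K : ℝ) / m)) * ‖g w‖),
      (integrable_norm_rpow_mul hm hn hK hg).const_mul _, ?_⟩
    filter_upwards [ae_mem_hartogs hn] with w hw z hz
    have hMz : M z < M z₀ + 1 := hz.1
    rw [norm_mul]
    calc ‖monomialKernel m n K z w‖ * ‖g w‖
        ≤ C * (M z * ‖w.2‖ ^ (-(-(K : ℝ) / m))) * ‖g w‖ := by
          refine mul_le_mul_of_nonneg_right ((hbound z hz.2 w hw).trans ?_) (norm_nonneg _)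
          exact mul_le_mul_of_nonneg_left (hartogsMajorant_le hn _ hz.2 hw) hC
      _ ≤ C * ((M z₀ + 1) * ‖w.2‖ ^ (-(-(K : ℝ) / m))) * ‖g w‖ := by gcongr
      _ = _ := by ring

section Lp

variable {m n : ℕ} {p : ℝ} {f g : ℂ × ℂ → ℂ}

/-- The image of `|g|` under the positive operator dominating `monomialProjection`. -/
noncomputable def majorantOperator (m n : ℕ) (K : ℤ) (g : ℂ × ℂ → ℂ) (z : ℂ × ℂ) : ENNReal :=
  ∫⁻ w, ENNReal.ofReal (hartogsMajorant m n (-(K : ℝ) / m) z w) * ‖g w‖ₑ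
    ∂(volOn (hartogs ((m : ℝ) / n)))

theorem aemeasurable_majorantOperator {K : ℤ}
    (hg : AEStronglyMeasurable g (volOn (hartogs ((m : ℝ) / n)))) :
    AEMeasurable (majorantOperator m n K g) (volOn (hartogs ((m : ℝ) / n))) := by
  have : AEMeasurable (Function.uncurry fun z w : ℂ × ℂ =>
      ENNReal.ofReal (hartogsMajorant m n (-(K : ℝ) / m) z w) * ‖g w‖ₑ)
      ((volOn (hartogs ((m : ℝ) / n))).prod (volOn (hartogs ((m : ℝ) / n)))) :=
    (measurable_hartogsMajorant m n _).ennreal_ofReal.aemeasurable.mul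
      (hg.enorm.comp_quasiMeasurePreserving Measure.quasiMeasurePreserving_snd)
  exact this.lintegral_prod_right'

theorem lintegral_majorantOperator_rpow_lt_top (hm : 0 < m) (hn : 0 < n) {K : ℤ} (hK0 : K ≤ 0)
    (hp : 2 ≤ p) (hK : -(K : ℝ) / m * p < 2 + 2 * n / m)
    (hg : MemLp g (ENNReal.ofReal p) (volOn (hartogs ((m : ℝ) / n)))) :
    ∫⁻ z, majorantOperator m n K g z ^ p ∂(volOn (hartogs ((m : ℝ) / n))) < ⊤ := by
  have hp0 : 0 < p := by linarith
  have hK0' : (0 : ℝ) ≤ -(K : ℝ) / m :=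
    div_nonneg (by have : (K : ℝ) ≤ 0 := by exact_mod_cast hK0
                   linarith) (by positivity)
  obtain ⟨C, hC, h⟩ := lintegral_hartogsMajorant_rpow_le hm hn hK0' hp hK
  refine (h _ hg.aestronglyMeasurable.enorm).trans_lt (ENNReal.mul_lt_top hC.lt_top ?_)
  have := hg.eLpNorm_lt_top
  rw [eLpNorm_lt_top_iff_lintegral_rpow_enorm_lt_top (by simpa using hp0) ENNReal.ofReal_ne_top,
    ENNReal.toReal_ofReal hp0.le] at this
  exact this

theorem enorm_monomialKernel_le {K : ℤ} {C : ℝ} (hC : 0 ≤ C)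
    (h : ∀ z ∈ hartogs ((m : ℝ) / n), ∀ w ∈ hartogs ((m : ℝ) / n),
      ‖monomialKernel m n K z w‖ ≤ C * hartogsMajorant m n (-(K : ℝ) / m) z w)
    {z w : ℂ × ℂ} (hz : z ∈ hartogs ((m : ℝ) / n)) (hw : w ∈ hartogs ((m : ℝ) / n)) :
    ‖monomialKernel m n K z w‖ₑ ≤
      ENNReal.ofReal C * ENNReal.ofReal (hartogsMajorant m n (-(K : ℝ) / m) z w) := by
  rw [← ENNReal.ofReal_mul hC, ← ofReal_norm]
  exact ENNReal.ofReal_le_ofReal (h z hz w hw)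

theorem lintegral_enorm_monomialKernel_mul_le (hn : 0 < n) {K : ℤ} {C : ℝ} (hC : 0 ≤ C)
    (h : ∀ z ∈ hartogs ((m : ℝ) / n), ∀ w ∈ hartogs ((m : ℝ) / n),
      ‖monomialKernel m n K z w‖ ≤ C * hartogsMajorant m n (-(K : ℝ) / m) z w)
    {z : ℂ × ℂ} (hz : z ∈ hartogs ((m : ℝ) / n)) (g : ℂ × ℂ → ℂ) :
    ∫⁻ w, ‖monomialKernel m n K z w * g w‖ₑ ∂(volOn (hartogs ((m : ℝ) / n))) ≤
      ENNReal.ofReal C * majorantOperator m n K g z := by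
  rw [majorantOperator, ← lintegral_const_mul' _ _ ENNReal.ofReal_ne_top]
  refine lintegral_mono_ae ?_
  filter_upwards [ae_mem_hartogs hn] with w hw
  rw [enorm_mul, ← mul_assoc]
  exact mul_le_mul_left (enorm_monomialKernel_le hC h hz hw) _

theorem aestronglyMeasurable_monomialKernel_mul {K : ℤ}
    (hg : AEStronglyMeasurable g (volOn (hartogs ((m : ℝ) / n)))) :
    AEStronglyMeasurable (fun q : (ℂ × ℂ) × (ℂ × ℂ) => monomialKernel m n K q.1 q.2 * g q.2)
      ((volOn (hartogs ((m : ℝ) / n))).prod (volOn (hartogs ((m : ℝ) / n)))) :=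
  (measurable_monomialKernel m n K).aestronglyMeasurable.mul
    (hg.comp_quasiMeasurePreserving Measure.quasiMeasurePreserving_snd)

theorem memLp_monomialProjection (hm : 0 < m) (hn : 0 < n) {K : ℤ} (hK0 : K ≤ 0)
    (hp : 2 ≤ p) (hK : -(K : ℝ) / m * p < 2 + 2 * n / m)
    (hg : MemLp g (ENNReal.ofReal p) (volOn (hartogs ((m : ℝ) / n)))) :
    MemLp (monomialProjection m n K g) (ENNReal.ofReal p) (volOn (hartogs ((m : ℝ) / n))) := by
  have hp0 : 0 < p := by linarith
  obtain ⟨C, hC, hbound⟩ := norm_monomialKernel_le hm hn K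
  refine ⟨(aestronglyMeasurable_monomialKernel_mul hg.aestronglyMeasurable).integral_prod_right', ?_⟩
  rw [eLpNorm_lt_top_iff_lintegral_rpow_enorm_lt_top (by simpa using hp0) ENNReal.ofReal_ne_top,
    ENNReal.toReal_ofReal hp0.le]
  calc ∫⁻ z, ‖monomialProjection m n K g z‖ₑ ^ p ∂(volOn (hartogs ((m : ℝ) / n)))
      ≤ ∫⁻ z, ENNReal.ofReal C ^ p * majorantOperator m n K g z ^ p
          ∂(volOn (hartogs ((m : ℝ) / n))) := by
        refine lintegral_mono_ae ?_
        filter_upwards [ae_mem_hartogs hn] with z hz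
        rw [← ENNReal.mul_rpow_of_nonneg _ _ hp0.le]
        refine ENNReal.rpow_le_rpow ?_ hp0.le
        exact (enorm_integral_le_lintegral_enorm _).trans
          (lintegral_enorm_monomialKernel_mul_le hn hC hbound hz g)
    _ < ⊤ := by
        rw [lintegral_const_mul' _ _ (ENNReal.rpow_ne_top_of_nonneg hp0.le ENNReal.ofReal_ne_top)]
        exact ENNReal.mul_lt_top (ENNReal.rpow_ne_top_of_nonneg hp0.le ENNReal.ofReal_ne_top).lt_top
          (lintegral_majorantOperator_rpow_lt_top hm hn hK0 hp hK hg)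

/-- The operator `monomialProjection` is symmetric. -/
theorem integral_conj_mul_monomialProjection (hm : 0 < m) (hn : 0 < n) {K : ℤ} (hK0 : K ≤ 0)
    (hp : 2 ≤ p) (hK : -(K : ℝ) / m * p < 2 + 2 * n / m)
    (hf : MemLp f (ENNReal.ofReal p) (volOn (hartogs ((m : ℝ) / n))))
    (hg : MemLp g (ENNReal.ofReal p) (volOn (hartogs ((m : ℝ) / n)))) :
    ∫ z, conj (f z) * monomialProjection m n K g z ∂(volOn (hartogs ((m : ℝ) / n))) =
      ∫ w, conj (monomialProjection m n K f w) * g w ∂(volOn (hartogs ((m : ℝ) / n))) := by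
  have hp0 : 0 < p := by linarith
  have hfin := isFiniteMeasure_volOn_hartogs hm hn
  obtain ⟨C, hC, hbound⟩ := norm_monomialKernel_le hm hn K
  set μ := volOn (hartogs ((m : ℝ) / n)) with hμ
  have hmeas : AEStronglyMeasurable (fun q : (ℂ × ℂ) × (ℂ × ℂ) =>
      conj (f q.1) * (monomialKernel m n K q.1 q.2 * g q.2)) (μ.prod μ) :=
    (Complex.continuous_conj.comp_aestronglyMeasurable
      (hf.aestronglyMeasurable.comp_quasiMeasurePreserving Measure.quasiMeasurePreserving_fst)).mul
      (aestronglyMeasurable_monomialKernel_mul hg.aestronglyMeasurable)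
  have hint : Integrable (fun q : (ℂ × ℂ) × (ℂ × ℂ) =>
      conj (f q.1) * (monomialKernel m n K q.1 q.2 * g q.2)) (μ.prod μ) := by
    refine ⟨hmeas, ?_⟩
    rw [hasFiniteIntegral_iff_enorm, lintegral_prod _ hmeas.enorm]
    have hq : (p / (p - 1)).HolderConjugate p := (Real.HolderConjugate.conjExponent (by linarith)).symm
    calc ∫⁻ z, ∫⁻ w, ‖conj (f z) * (monomialKernel m n K z w * g w)‖ₑ ∂μ ∂μ
        ≤ ∫⁻ z, ENNReal.ofReal C * (‖f z‖ₑ * majorantOperator m n K g z) ∂μ := by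
          refine lintegral_mono_ae ?_
          filter_upwards [ae_mem_hartogs hn] with z hz
          simp_rw [enorm_mul (conj (f z))]
          rw [lintegral_const_mul' _ _ enorm_ne_top, RCLike.enorm_conj]
          refine (mul_le_mul_right (lintegral_enorm_monomialKernel_mul_le hn hC hbound hz g) _).trans
            (le_of_eq (by ring))
      _ = ENNReal.ofReal C * ∫⁻ z, ‖f z‖ₑ * majorantOperator m n K g z ∂μ :=
          lintegral_const_mul' _ _ ENNReal.ofReal_ne_top
      _ < ⊤ := by
          refine ENNReal.mul_lt_top ENNReal.ofReal_lt_top ?_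
          refine (ENNReal.lintegral_mul_le_Lp_mul_Lq μ hq hf.aestronglyMeasurable.enorm
            (aemeasurable_majorantOperator hg.aestronglyMeasurable)).trans_lt ?_
          refine ENNReal.mul_lt_top (ENNReal.rpow_lt_top_of_nonneg
            (by have := hq.pos; positivity) ?_) (ENNReal.rpow_lt_top_of_nonneg (by positivity)
            (lintegral_majorantOperator_rpow_lt_top hm hn hK0 hp hK hg).ne)
          -- The conjugate exponent satisfies `p / (p - 1) ≤ p` because `p ≥ 2`, and the measure is
          -- finite.
          have hfq : MemLp f (ENNReal.ofReal (p / (p - 1))) μ := by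
            refine hf.mono_exponent (ENNReal.ofReal_le_ofReal ?_)
            rw [div_le_iff₀ (by linarith)]
            nlinarith
          have := hfq.eLpNorm_lt_top
          rw [eLpNorm_lt_top_iff_lintegral_rpow_enorm_lt_top (by simpa using hq.pos)
            ENNReal.ofReal_ne_top, ENNReal.toReal_ofReal hq.pos.le] at this
          exact this.ne
  have h1 : ∀ z, conj (f z) * monomialProjection m n K g z =
      ∫ w, conj (f z) * (monomialKernel m n K z w * g w) ∂μ := fun z =>
    (integral_const_mul _ _).symm
  have h2 : ∀ w, conj (monomialProjection m n K f w) * g w =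
      ∫ z, conj (f z) * (monomialKernel m n K z w * g w) ∂μ := by
    intro w
    rw [monomialProjection, ← integral_conj, ← integral_mul_const]
    refine integral_congr_ae (Filter.Eventually.of_forall fun z => ?_)
    simp only [map_mul, conj_monomialKernel]
    ring
  simp_rw [h1, h2]
  exact integral_integral_swap hint

end Lp

/-! ### Fourier coefficients of holomorphic functions on tori -/

theorem circleAverage_eq_of_differentiable_on_annulus {f : ℂ → ℂ} {r R : ℝ} (hr : 0 < r)
    (hrR : r ≤ R) (hf : ∀ z, r ≤ ‖z‖ → ‖z‖ ≤ R → DifferentiableAt ℂ f z) :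
    Real.circleAverage f 0 r = Real.circleAverage f 0 R := by
  rw [Real.circleAverage_eq_circleIntegral hr.ne',
    Real.circleAverage_eq_circleIntegral (hr.trans_le hrR).ne']
  congr 1
  symm
  refine Complex.circleIntegral_sub_center_inv_smul_eq_of_differentiable_on_annulus_off_countable
    hr hrR countable_empty ?_ ?_
  · rintro z ⟨h1, h2⟩
    exact (hf z (by simpa using h2) (by simpa using h1)).continuousAt.continuousWithinAt
  · rintro z ⟨⟨h1, h2⟩, -⟩
    have h1' : ‖z‖ < R := by simpa using h1
    have h2' : r < ‖z‖ := by simpa using h2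
    exact hf z h2'.le h1'.le

theorem integral_fourier_mul_eq_of_differentiable_on_annulus {f : ℂ → ℂ} {w w' : ℂ} (hw : w ≠ 0)
    (hw' : w' ≠ 0) (hf : ∀ z, min ‖w‖ ‖w'‖ ≤ ‖z‖ → ‖z‖ ≤ max ‖w‖ ‖w'‖ → DifferentiableAt ℂ f z) :
    ∫ θ : UnitAddCircle, f (fourier 1 θ * w) = ∫ θ : UnitAddCircle, f (fourier 1 θ * w') := by
  rw [integral_fourier_mul_eq_circleAverage, integral_fourier_mul_eq_circleAverage]
  rcases le_total ‖w‖ ‖w'‖ with h | h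
  · refine circleAverage_eq_of_differentiable_on_annulus (norm_pos_iff.2 hw) h fun z h1 h2 => ?_
    exact hf z (by rwa [min_eq_left h]) (by rwa [max_eq_right h])
  · symm
    refine circleAverage_eq_of_differentiable_on_annulus (norm_pos_iff.2 hw') h fun z h1 h2 => ?_
    exact hf z (by rwa [min_eq_right h]) (by rwa [max_eq_left h])

/-- The domain is stable under shrinking `‖z.1‖` and enlarging `‖z.2‖` below one. This keeps the
annuli swept out when one modulus varies inside the domain. -/
theorem mem_hartogs_of_norm_le {m n : ℕ} (hn : 0 < n) {z w : ℂ × ℂ}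
    (hz : z ∈ hartogs ((m : ℝ) / n)) (h1 : ‖w.1‖ ≤ ‖z.1‖) (h2 : ‖z.2‖ ≤ ‖w.2‖) (h3 : ‖w.2‖ < 1) :
    w ∈ hartogs ((m : ℝ) / n) := by
  rw [mem_hartogs_iff hn] at hz ⊢
  exact ⟨(pow_le_pow_left₀ (norm_nonneg _) h1 m).trans_lt
    (hz.1.trans_le (pow_le_pow_left₀ (norm_nonneg _) h2 n)), h3⟩

section Torus

variable {m n : ℕ} {G : ℂ × ℂ → ℂ}

/-- The average over tori of a function holomorphic off the axis `z₁ = 0` is constant. -/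
theorem integral_torusRotation_eq_of_differentiableAt (hn : 0 < n)
    (hG : ∀ z ∈ hartogs ((m : ℝ) / n), z.1 ≠ 0 → DifferentiableAt ℂ G z) {z z' : ℂ × ℂ}
    (hz : z ∈ hartogs ((m : ℝ) / n)) (hz1 : z.1 ≠ 0) (hz' : z' ∈ hartogs ((m : ℝ) / n))
    (hz1' : z'.1 ≠ 0) :
    ∫ θ : UnitAddCircle × UnitAddCircle, G (torusRotation θ z) =
      ∫ θ : UnitAddCircle × UnitAddCircle, G (torusRotation θ z') := by
  have hcont : ∀ z ∈ hartogs ((m : ℝ) / n), z.1 ≠ 0 → Integrable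
      (fun θ : UnitAddCircle × UnitAddCircle => G (torusRotation θ z)) (volume.prod volume) := by
    intro z hz hz1
    have : Continuous fun θ : UnitAddCircle × UnitAddCircle => G (torusRotation θ z) := by
      rw [continuous_iff_continuousAt]
      intro θ
      refine ContinuousAt.comp (f := fun θ => torusRotation θ z) (hG _
        (torusRotation_mem_hartogs.2 hz) (mul_ne_zero (fourier_one_ne_zero _) hz1)).continuousAt ?_
      exact (continuous_torusRotation.comp (by fun_prop : Continuous fun θ => (θ, z))).continuousAt
    rw [← Measure.volume_eq_prod]
    exact this.integrable_of_hasCompactSupport (HasCompactSupport.of_compactSpace _)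
  have hsnd : ∀ ζ w w' : ℂ, ζ ≠ 0 → (ζ, w) ∈ hartogs ((m : ℝ) / n) →
      (ζ, w') ∈ hartogs ((m : ℝ) / n) →
      ∫ θ : UnitAddCircle × UnitAddCircle, G (torusRotation θ (ζ, w)) =
        ∫ θ : UnitAddCircle × UnitAddCircle, G (torusRotation θ (ζ, w')) := by
    intro ζ w w' hζ hw hw'
    rw [Measure.volume_eq_prod, integral_prod _ (hcont _ hw hζ), integral_prod _ (hcont _ hw' hζ)]
    refine integral_congr_ae (Filter.Eventually.of_forall fun θ => ?_)
    refine integral_fourier_mul_eq_of_differentiable_on_annulus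
      (f := fun η => G (fourier 1 θ * ζ, η)) (snd_ne_zero_of_mem_hartogs hn hw)
      (snd_ne_zero_of_mem_hartogs hn hw') fun η h1 h2 => ?_
    have hmem : (fourier 1 θ * ζ, η) ∈ hartogs ((m : ℝ) / n) := by
      have hlt : ‖η‖ < 1 := h2.trans_lt (max_lt ((mem_hartogs_iff hn).1 hw).2
        ((mem_hartogs_iff hn).1 hw').2)
      rcases min_le_iff.1 h1 with h | h
      · exact mem_hartogs_of_norm_le hn hw (norm_fourier_one_mul _ _).le h hlt
      · exact mem_hartogs_of_norm_le hn hw' (norm_fourier_one_mul _ _).le h hlt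
    exact DifferentiableAt.comp η (hG _ hmem (mul_ne_zero (fourier_one_ne_zero _) hζ))
      (by fun_prop : DifferentiableAt ℂ (fun η : ℂ => ((fourier 1 θ * ζ, η) : ℂ × ℂ)) η)
  have hfst : ∀ ζ ζ' w : ℂ, ζ ≠ 0 → ζ' ≠ 0 → (ζ, w) ∈ hartogs ((m : ℝ) / n) →
      (ζ', w) ∈ hartogs ((m : ℝ) / n) →
      ∫ θ : UnitAddCircle × UnitAddCircle, G (torusRotation θ (ζ, w)) =
        ∫ θ : UnitAddCircle × UnitAddCircle, G (torusRotation θ (ζ', w)) := by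
    intro ζ ζ' w hζ hζ' hw hw'
    rw [Measure.volume_eq_prod, integral_prod_symm _ (hcont _ hw hζ),
      integral_prod_symm _ (hcont _ hw' hζ')]
    refine integral_congr_ae (Filter.Eventually.of_forall fun θ => ?_)
    refine integral_fourier_mul_eq_of_differentiable_on_annulus
      (f := fun η => G (η, fourier 1 θ * w)) hζ hζ' fun η h1 h2 => ?_
    have hmem : (η, fourier 1 θ * w) ∈ hartogs ((m : ℝ) / n) := by
      have hlt : ‖(fourier 1 θ : ℂ) * w‖ < 1 := by
        rw [norm_fourier_one_mul]
        exact ((mem_hartogs_iff hn).1 hw).2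
      rcases le_max_iff.1 h2 with h | h
      · exact mem_hartogs_of_norm_le hn hw h (norm_fourier_one_mul _ _).ge hlt
      · exact mem_hartogs_of_norm_le hn hw' h (norm_fourier_one_mul _ _).ge hlt
    have hη : η ≠ 0 := by
      rw [← norm_pos_iff]
      exact (lt_min (norm_pos_iff.2 hζ) (norm_pos_iff.2 hζ')).trans_le h1
    exact DifferentiableAt.comp η (hG _ hmem hη)
      (by fun_prop : DifferentiableAt ℂ (fun η : ℂ => ((η, fourier 1 θ * w) : ℂ × ℂ)) η)
  -- Two tori are joined by changing first the second modulus, then the first. The corner `(z.1,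
  -- z'.2)` lies in the domain when `‖z.1‖ ≤ ‖z'.1‖`; otherwise the two points exchange roles.
  have key : ∀ z z' : ℂ × ℂ, z ∈ hartogs ((m : ℝ) / n) → z.1 ≠ 0 → z' ∈ hartogs ((m : ℝ) / n) →
      z'.1 ≠ 0 → ‖z.1‖ ≤ ‖z'.1‖ →
      ∫ θ : UnitAddCircle × UnitAddCircle, G (torusRotation θ z) =
        ∫ θ : UnitAddCircle × UnitAddCircle, G (torusRotation θ z') := by
    intro z z' hz hz1 hz' hz1' hle
    have hmem : (z.1, z'.2) ∈ hartogs ((m : ℝ) / n) :=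
      mem_hartogs_of_norm_le hn hz' hle le_rfl ((mem_hartogs_iff hn).1 hz').2
    exact (hsnd z.1 z.2 z'.2 hz1 hz hmem).trans (hfst z.1 z'.1 z'.2 hz1 hz1' hmem hz')
  rcases le_total ‖z.1‖ ‖z'.1‖ with h | h
  · exact key z z' hz hz1 hz' hz1' h
  · exact (key z' z hz' hz1' hz hz1 h).symm

end Torus

/-- The Fourier coefficients on tori of a holomorphic function are monomials. -/
theorem exists_torusCoeff_eq {m n : ℕ} (hn : 0 < n) {f : ℂ × ℂ → ℂ}
    (hf : DifferentiableOn ℂ f (hartogs ((m : ℝ) / n))) (a b : ℤ) :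
    ∃ c : ℂ, ∀ z ∈ hartogs ((m : ℝ) / n), z.1 ≠ 0 →
      torusCoeff a b f z = c * (z.1 ^ a * z.2 ^ b) := by
  by_cases hne : ∃ z₀ ∈ hartogs ((m : ℝ) / n), z₀.1 ≠ 0
  · obtain ⟨z₀, hz₀, hz₀1⟩ := hne
    -- Removing the expected monomial turns the Fourier coefficient into a torus average, which is
    -- constant: it is the Laurent coefficient. Negative powers of `z.1` are why the axis `z.1 = 0`
    -- is avoided.
    set G : ℂ × ℂ → ℂ := fun z => z.1 ^ (-a) * z.2 ^ (-b) * f z with hG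
    refine ⟨∫ θ : UnitAddCircle × UnitAddCircle, G (torusRotation θ z₀), fun z hz hz1 => ?_⟩
    have hGd : ∀ z ∈ hartogs ((m : ℝ) / n), z.1 ≠ 0 → DifferentiableAt ℂ G z := by
      intro z hz hz1
      have h2 := snd_ne_zero_of_mem_hartogs hn hz
      exact ((DifferentiableAt.zpow (by fun_prop) (Or.inl hz1)).mul
        (DifferentiableAt.zpow (by fun_prop) (Or.inl h2))).mul
        (hf.differentiableAt ((isOpen_hartogs hn).mem_nhds hz))
    rw [integral_torusRotation_eq_of_differentiableAt hn hGd hz₀ hz₀1 hz hz1, ← integral_mul_const,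
      torusCoeff]
    refine integral_congr_ae (Filter.Eventually.of_forall fun θ => ?_)
    have h2 := snd_ne_zero_of_mem_hartogs hn hz
    have e1 : z.1 ^ (-a) * z.1 ^ a = 1 := by rw [← zpow_add₀ hz1, neg_add_cancel, zpow_zero]
    have e2 : z.2 ^ (-b) * z.2 ^ b = 1 := by rw [← zpow_add₀ h2, neg_add_cancel, zpow_zero]
    simp only [hG, torusRotation]
    rw [mul_zpow, mul_zpow, fourier_one_zpow, fourier_one_zpow]
    calc _ = fourier (-a) θ.1 * fourier (-b) θ.2 * f (fourier 1 θ.1 * z.1, fourier 1 θ.2 * z.2) *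
          ((z.1 ^ (-a) * z.1 ^ a) * (z.2 ^ (-b) * z.2 ^ b)) := by rw [e1, e2]; ring
      _ = _ := by ring
  · exact ⟨0, fun z hz hz1 => absurd ⟨z, hz, hz1⟩ hne⟩

/-! ### Fourier uniqueness, norms of monomials, and the monomials occurring in `A^p` -/

theorem eq_zero_of_fourierCoeff_eq_zero {u : UnitAddCircle → ℂ} (hu : Continuous u)
    (h : ∀ a : ℤ, ∫ θ : UnitAddCircle, fourier (-a) θ * u θ = 0) (θ : UnitAddCircle) : u θ = 0 := by
  have h0 : ∀ a : ℤ, fourierCoeff (⟨u, hu⟩ : C(UnitAddCircle, ℂ)) a = 0 := by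
    intro a
    rw [fourierCoeff, AddCircle.integral_haarAddCircle]
    simpa using h a
  have hs := has_pointwise_sum_fourier_series_of_summable (f := (⟨u, hu⟩ : C(UnitAddCircle, ℂ)))
    (by rw [funext h0]; exact summable_zero) θ
  simp only [h0, zero_smul] at hs
  exact (hasSum_zero.unique hs).symm

/-- One-variable uniqueness applied twice: for fixed `b`, the `b`-th coefficient in the second angle
is a continuous function of the first angle with vanishing coefficients. -/
theorem eq_zero_of_torus_fourierCoeff_eq_zero {u : UnitAddCircle × UnitAddCircle → ℂ}
    (hu : Continuous u)
    (h : ∀ a b : ℤ, ∫ θ : UnitAddCircle × UnitAddCircle,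
      fourier (-a) θ.1 * fourier (-b) θ.2 * u θ = 0)
    (θ : UnitAddCircle × UnitAddCircle) : u θ = 0 := by
  have hv : ∀ b : ℤ, Continuous fun x : UnitAddCircle =>
      ∫ y : UnitAddCircle, fourier (-b) y * u (x, y) := by
    intro b
    have := continuous_parametric_integral_of_continuous (μ := (volume : Measure UnitAddCircle))
      (f := fun x y : UnitAddCircle => (fourier (-b) y * u (x, y) : ℂ))
      (by unfold Function.uncurry; fun_prop) (isCompact_univ)
    simpa using this
  have h1 : ∀ (b : ℤ) (x : UnitAddCircle), ∫ y : UnitAddCircle, fourier (-b) y * u (x, y) = 0 := by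
    intro b
    refine eq_zero_of_fourierCoeff_eq_zero (hv b) fun a => ?_
    rw [← h a b, Measure.volume_eq_prod, integral_prod]
    · refine integral_congr_ae (Filter.Eventually.of_forall fun x => ?_)
      simp only [mul_assoc]
      rw [integral_const_mul]
    · rw [← Measure.volume_eq_prod]
      exact (by fun_prop : Continuous fun θ : UnitAddCircle × UnitAddCircle =>
        fourier (-a) θ.1 * fourier (-b) θ.2 * u θ).integrable_of_hasCompactSupport
        (HasCompactSupport.of_compactSpace _)
  exact eq_zero_of_fourierCoeff_eq_zero (u := fun y => u (θ.1, y)) (by fun_prop)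
    (fun b => h1 b θ.1) θ.2

theorem lintegral_enorm_monomial_rpow {m n : ℕ} (hm : 0 < m) (hn : 0 < n) (a b : ℤ) {p : ℝ}
    (hp : 0 ≤ p) :
    ∫⁻ w : ℂ × ℂ, ‖w.1 ^ a * w.2 ^ b‖ₑ ^ p ∂(volOn (hartogs ((m : ℝ) / n))) =
      if -2 < a * p ∧ -2 < b * p + n / m * (a * p + 2) then
        ENNReal.ofReal (2 * Real.pi / (a * p + 2) *
          (2 * Real.pi / (b * p + n / m * (a * p + 2) + 2))) else ⊤ := by
  rw [← lintegral_hartogs_rpow hm hn]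
  refine lintegral_congr fun w => ?_
  rw [← ofReal_norm, ENNReal.ofReal_rpow_of_nonneg (norm_nonneg _) hp, norm_mul, norm_zpow,
    norm_zpow, ← Real.rpow_intCast, ← Real.rpow_intCast, Real.mul_rpow (by positivity) (by positivity),
    ← Real.rpow_mul (norm_nonneg _), ← Real.rpow_mul (norm_nonneg _)]

/-- The norm computed here is the inverse of the coefficient in `kernelMonomial`, which is what
makes the kernel reproducing. -/
theorem memLp_two_monomial {m n : ℕ} (hm : 0 < m) (hn : 0 < n) {a b : ℤ} (ha : 0 ≤ a)
    (hab : 0 < n * a + m * b + m + n) :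
    MemLp (fun w : ℂ × ℂ => w.1 ^ a * w.2 ^ b) 2 (volOn (hartogs ((m : ℝ) / n))) ∧
      ∫ w : ℂ × ℂ, ((‖w.1 ^ a * w.2 ^ b‖ ^ 2 : ℝ) : ℂ) ∂(volOn (hartogs ((m : ℝ) / n))) =
        (Real.pi : ℂ) ^ 2 * m / (((a + 1 : ℤ) : ℂ) * ((n * a + m * b + m + n : ℤ) : ℂ)) := by
  have hm' : (0 : ℝ) < m := by exact_mod_cast hm
  have ha' : (0 : ℝ) ≤ a := by exact_mod_cast ha
  have hab' : (0 : ℝ) < n * a + m * b + m + n := by exact_mod_cast hab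
  have hmeas : Measurable fun w : ℂ × ℂ => w.1 ^ a * w.2 ^ b :=
    (measurable_fst.pow_const a).mul (measurable_snd.pow_const b)
  have he : (b : ℝ) * 2 + n / m * (a * 2 + 2) + 2 = 2 * (n * a + m * b + m + n) / m := by
    field_simp
    ring
  have hpos : (0 : ℝ) < b * 2 + n / m * (a * 2 + 2) + 2 := by
    rw [he]; positivity
  have h := lintegral_enorm_monomial_rpow hm hn a b (p := 2) two_pos.le
  rw [if_pos ⟨by linarith, by linarith⟩, he] at h
  have e2 : 2 * Real.pi / (a * 2 + 2) * (2 * Real.pi / (2 * (n * a + m * b + m + n) / m)) =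
      Real.pi ^ 2 * m / ((a + 1) * (n * a + m * b + m + n)) := by
    have : (a : ℝ) * 2 + 2 = 2 * (a + 1) := by ring
    rw [this]
    field_simp
  rw [e2] at h
  refine ⟨⟨hmeas.aestronglyMeasurable, ?_⟩, ?_⟩
  · rw [eLpNorm_lt_top_iff_lintegral_rpow_enorm_lt_top two_ne_zero ENNReal.ofNat_ne_top,
      ENNReal.toReal_ofNat, h]
    exact ENNReal.ofReal_lt_top
  · rw [integral_complex_ofReal, integral_eq_lintegral_of_nonneg_ae
      (Filter.Eventually.of_forall fun w => by positivity)
      (hmeas.norm.pow_const 2).aestronglyMeasurable]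
    have e3 : ∀ w : ℂ × ℂ, ENNReal.ofReal (‖w.1 ^ a * w.2 ^ b‖ ^ 2) =
        ‖w.1 ^ a * w.2 ^ b‖ₑ ^ (2 : ℝ) := by
      intro w
      rw [← ofReal_norm, ENNReal.ofReal_rpow_of_nonneg (norm_nonneg _) two_pos.le, Real.rpow_two]
    simp_rw [e3]
    rw [h, ENNReal.toReal_ofReal (by positivity)]
    push_cast
    rfl

theorem ae_fst_ne_zero (Ω : Set (ℂ × ℂ)) : ∀ᵐ z ∂(volOn Ω), z.1 ≠ 0 := by
  refine ae_restrict_of_ae ?_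
  have h : ∀ᵐ x : ℂ, x ≠ 0 := by simp [ae_iff, measure_singleton]
  rw [Measure.volume_eq_prod]
  exact Measure.quasiMeasurePreserving_fst.ae h

/-- Averaging over tori first isolates the Laurent coefficient `c` inside the integral, so no
convergence of a Laurent series in `L²` is needed. -/
theorem integral_mul_conj_monomial {m n : ℕ} (hn : 0 < n) {f : ℂ × ℂ → ℂ} {a b : ℤ} {c : ℂ}
    (hf : Integrable (fun w : ℂ × ℂ => f w * conj (w.1 ^ a * w.2 ^ b))
      (volOn (hartogs ((m : ℝ) / n))))
    (hc : ∀ z ∈ hartogs ((m : ℝ) / n), z.1 ≠ 0 → torusCoeff a b f z = c * (z.1 ^ a * z.2 ^ b)) :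
    ∫ w, f w * conj (w.1 ^ a * w.2 ^ b) ∂(volOn (hartogs ((m : ℝ) / n))) =
      c * ∫ w : ℂ × ℂ, ((‖w.1 ^ a * w.2 ^ b‖ ^ 2 : ℝ) : ℂ) ∂(volOn (hartogs ((m : ℝ) / n))) := by
  rw [integral_torusRotation hn hf, ← integral_const_mul]
  refine integral_congr_ae ?_
  filter_upwards [ae_mem_hartogs hn, ae_fst_ne_zero _] with w hw hw1
  have e : ∀ θ : UnitAddCircle × UnitAddCircle, f (torusRotation θ w) *
      conj ((torusRotation θ w).1 ^ a * (torusRotation θ w).2 ^ b) =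
      fourier (-a) θ.1 * fourier (-b) θ.2 * f (torusRotation θ w) * conj (w.1 ^ a * w.2 ^ b) := by
    intro θ
    simp only [torusRotation]
    rw [mul_zpow, mul_zpow, fourier_one_zpow, fourier_one_zpow]
    simp only [map_mul, fourier_neg]
    ring
  simp_rw [e]
  rw [integral_mul_const, ← torusCoeff, hc w hw hw1, mul_assoc, Complex.mul_conj,
    Complex.normSq_eq_norm_sq]

/-- A Fourier coefficient is a mean over a probability space, so its `p`-th power is at most the
mean of `‖f‖ ^ p` by Hölder; integrating over the domain undoes the averaging. -/
theorem lintegral_torusCoeff_rpow_le {m n : ℕ} (hn : 0 < n) {f : ℂ × ℂ → ℂ} {p : ℝ} (hp : 1 < p)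
    (hf : ContinuousOn f (hartogs ((m : ℝ) / n))) (a b : ℤ) :
    ∫⁻ z, ‖torusCoeff a b f z‖ₑ ^ p ∂(volOn (hartogs ((m : ℝ) / n))) ≤
      ∫⁻ z, ‖f z‖ₑ ^ p ∂(volOn (hartogs ((m : ℝ) / n))) := by
  have hp0 : 0 < p := by linarith
  have hfm : AEMeasurable f (volOn (hartogs ((m : ℝ) / n))) :=
    hf.aemeasurable (isOpen_hartogs hn).measurableSet
  rw [lintegral_torusRotation hn (F := fun z => ‖f z‖ₑ ^ p) (hfm.enorm.pow_const _)]
  refine lintegral_mono_ae ?_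
  filter_upwards [ae_mem_hartogs hn] with z hz
  have hcont : Continuous fun θ : UnitAddCircle × UnitAddCircle => f (torusRotation θ z) :=
    hf.comp_continuous (continuous_torusRotation.comp (by fun_prop : Continuous fun θ => (θ, z)))
      fun θ => torusRotation_mem_hartogs.2 hz
  have h1 : ‖torusCoeff a b f z‖ₑ ≤ ∫⁻ θ, ‖f (torusRotation θ z)‖ₑ := by
    refine (enorm_integral_le_lintegral_enorm _).trans (le_of_eq (lintegral_congr fun θ => ?_))
    rw [enorm_mul, ← ofReal_norm, norm_fourier_mul_fourier, ENNReal.ofReal_one, one_mul]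
  have hq : p.HolderConjugate (p / (p - 1)) := Real.HolderConjugate.conjExponent hp
  have h2 := ENNReal.lintegral_mul_le_Lp_mul_Lq (volume : Measure (UnitAddCircle × UnitAddCircle)) hq
    (f := fun θ => ‖f (torusRotation θ z)‖ₑ) (g := fun _ => 1) hcont.enorm.measurable.aemeasurable
    aemeasurable_const
  simp only [Pi.mul_apply, mul_one, ENNReal.one_rpow, lintegral_const, measure_univ] at h2
  calc ‖torusCoeff a b f z‖ₑ ^ p ≤ ((∫⁻ θ, ‖f (torusRotation θ z)‖ₑ ^ p) ^ (1 / p)) ^ p :=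
        ENNReal.rpow_le_rpow (h1.trans h2) hp0.le
    _ = _ := by rw [← ENNReal.rpow_mul, one_div_mul_cancel hp0.ne', ENNReal.rpow_one]

/-- Only the `L^p` monomials occur in the Laurent expansion of a function in `A^p`. -/
theorem exponent_of_torusCoeff_ne_zero {m n : ℕ} (hm : 0 < m) (hn : 0 < n) {f : ℂ × ℂ → ℂ} {p : ℝ}
    (hp : 2 ≤ p) (hf : f ∈ bergmanSpace (ENNReal.ofReal p) (hartogs ((m : ℝ) / n))) {a b : ℤ}
    {c : ℂ} (hc0 : c ≠ 0)
    (hc : ∀ z ∈ hartogs ((m : ℝ) / n), z.1 ≠ 0 → torusCoeff a b f z = c * (z.1 ^ a * z.2 ^ b)) :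
    0 ≤ a ∧ -(2 * (m + n) : ℝ) < (n * a + m * b : ℤ) * p := by
  have hp0 : 0 < p := by linarith
  have hm' : (0 : ℝ) < m := by exact_mod_cast hm
  have h1 := lintegral_torusCoeff_rpow_le hn (by linarith : 1 < p) hf.1.continuousOn a b
  have h2 : ∫⁻ z, ‖torusCoeff a b f z‖ₑ ^ p ∂(volOn (hartogs ((m : ℝ) / n))) =
      ‖c‖ₑ ^ p * ∫⁻ w : ℂ × ℂ, ‖w.1 ^ a * w.2 ^ b‖ₑ ^ p ∂(volOn (hartogs ((m : ℝ) / n))) := by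
    rw [← lintegral_const_mul' _ _ (ENNReal.rpow_ne_top_of_nonneg hp0.le enorm_ne_top)]
    refine lintegral_congr_ae ?_
    filter_upwards [ae_mem_hartogs hn, ae_fst_ne_zero _] with w hw hw1
    rw [hc w hw hw1, enorm_mul, ENNReal.mul_rpow_of_nonneg _ _ hp0.le]
  have h3 := hf.2.eLpNorm_lt_top
  rw [eLpNorm_lt_top_iff_lintegral_rpow_enorm_lt_top (by simpa using hp0) ENNReal.ofReal_ne_top,
    ENNReal.toReal_ofReal hp0.le] at h3
  rw [h2, lintegral_enorm_monomial_rpow hm hn a b hp0.le] at h1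
  have hcpos : ‖c‖ₑ ^ p ≠ 0 := by
    rw [Ne, ENNReal.rpow_eq_zero_iff_of_pos hp0]
    exact enorm_ne_zero.2 hc0
  split_ifs at h1 with h
  · refine ⟨?_, ?_⟩
    -- From `a * p > -2` and `p ≥ 2` one gets `a > -1`, hence `a ≥ 0` for an integer.
    · have h4 : (-1 : ℝ) < a := by nlinarith [h.1]
      have h5 : (-1 : ℤ) < a := by exact_mod_cast h4
      omega
    · have h5 := h.2
      have : (b : ℝ) * p + n / m * (a * p + 2) = ((n * a + m * b) * p + 2 * n) / m := by
        field_simp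
        ring
      rw [this, lt_div_iff₀ hm'] at h5
      push_cast
      linarith
  · rw [ENNReal.mul_top hcpos] at h1
    exact absurd (h1.trans_lt h3) (lt_irrefl _)

/-! ### Reproduction of `A^p` -/

/-- Fubini, with a dominating function that depends on `z` only through its moduli and is therefore
the same on the whole torus. -/
theorem torusCoeff_monomialProjection {m n : ℕ} (hm : 0 < m) (hn : 0 < n) {K : ℤ}
    (hK : -(K : ℝ) / m * 2 < 2 + 2 * n / m) {f : ℂ × ℂ → ℂ}
    (hf : MemLp f 2 (volOn (hartogs ((m : ℝ) / n)))) (a b : ℤ) {z : ℂ × ℂ}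
    (hz : z ∈ hartogs ((m : ℝ) / n)) :
    torusCoeff a b (monomialProjection m n K f) z =
      ∫ w, torusCoeff a b (fun z => monomialKernel m n K z w) z * f w
        ∂(volOn (hartogs ((m : ℝ) / n))) := by
  obtain ⟨C, hC, hbound⟩ := norm_monomialKernel_le hm hn K
  set M : ℝ := C * (‖z.2‖ ^ (-(-(K : ℝ) / m)) * ((1 - ‖z.1‖ ^ m / ‖z.2‖ ^ n) ^ 2)⁻¹ *
    ((1 - ‖z.2‖) ^ 2)⁻¹) with hM
  have hint : Integrable (Function.uncurry fun (θ : UnitAddCircle × UnitAddCircle) (w : ℂ × ℂ) =>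
      fourier (-a) θ.1 * fourier (-b) θ.2 * (monomialKernel m n K (torusRotation θ z) w * f w))
      (volume.prod (volOn (hartogs ((m : ℝ) / n)))) := by
    have hdom : Integrable (fun q : (UnitAddCircle × UnitAddCircle) × (ℂ × ℂ) =>
        M * (‖q.2.2‖ ^ (-(-(K : ℝ) / m)) * ‖f q.2‖))
        (volume.prod (volOn (hartogs ((m : ℝ) / n)))) :=
      ((integrable_norm_rpow_mul hm hn hK hf).comp_snd _).const_mul M
    refine hdom.mono' ?_ ?_
    · have h1 : Measurable fun q : (UnitAddCircle × UnitAddCircle) × (ℂ × ℂ) =>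
          monomialKernel m n K (torusRotation q.1 z) q.2 :=
        (measurable_monomialKernel m n K).comp (f := fun q : (UnitAddCircle × UnitAddCircle) ×
          (ℂ × ℂ) => (torusRotation q.1 z, q.2)) (Measurable.prodMk (continuous_torusRotation.comp
          (by fun_prop : Continuous fun q : (UnitAddCircle × UnitAddCircle) × (ℂ × ℂ) =>
            (q.1, z))).measurable measurable_snd)
      have h2 : Measurable fun q : (UnitAddCircle × UnitAddCircle) × (ℂ × ℂ) =>
          (fourier (-a) q.1.1 * fourier (-b) q.1.2 : ℂ) :=
        (by fun_prop : Continuous fun q : (UnitAddCircle × UnitAddCircle) × (ℂ × ℂ) =>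
          (fourier (-a) q.1.1 * fourier (-b) q.1.2 : ℂ)).measurable
      exact h2.aestronglyMeasurable.mul (h1.aestronglyMeasurable.mul
        (hf.aestronglyMeasurable.comp_quasiMeasurePreserving Measure.quasiMeasurePreserving_snd))
    · filter_upwards [Measure.quasiMeasurePreserving_snd.ae (ae_mem_hartogs (m := m) hn)] with q hq
      have hrot : torusRotation q.1 z ∈ hartogs ((m : ℝ) / n) := torusRotation_mem_hartogs.2 hz
      simp only [Function.uncurry]
      rw [norm_mul, norm_fourier_mul_fourier, one_mul, norm_mul, ← mul_assoc]
      refine mul_le_mul_of_nonneg_right ?_ (norm_nonneg _)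
      refine (hbound _ hrot _ hq).trans ?_
      rw [hM, mul_assoc]
      refine mul_le_mul_of_nonneg_left ((hartogsMajorant_le hn _ hrot hq).trans (le_of_eq ?_)) hC
      simp only [torusRotation, norm_fourier_one_mul]
  calc torusCoeff a b (monomialProjection m n K f) z
      = ∫ θ : UnitAddCircle × UnitAddCircle, ∫ w, fourier (-a) θ.1 * fourier (-b) θ.2 *
          (monomialKernel m n K (torusRotation θ z) w * f w) ∂(volOn (hartogs ((m : ℝ) / n))) := by
        unfold torusCoeff monomialProjection
        simp_rw [integral_const_mul]
    _ = ∫ w, (∫ θ : UnitAddCircle × UnitAddCircle, fourier (-a) θ.1 * fourier (-b) θ.2 *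
          (monomialKernel m n K (torusRotation θ z) w * f w)) ∂(volOn (hartogs ((m : ℝ) / n))) :=
        integral_integral_swap hint
    _ = _ := by
        unfold torusCoeff
        simp_rw [← integral_mul_const, mul_assoc]

/-- `monomialProjection` reproduces the functions in `A^p`. -/
theorem monomialProjection_eq_self {m n : ℕ} (hm : 0 < m) (hn : 0 < n) {K : ℤ} {p : ℝ}
    (hp : 2 ≤ p) (hK : -(K : ℝ) / m * 2 < 2 + 2 * n / m)
    (hK' : ∀ k : ℤ, -(2 * (m + n) : ℝ) < k * p → K ≤ k) {f : ℂ × ℂ → ℂ}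
    (hf : f ∈ bergmanSpace (ENNReal.ofReal p) (hartogs ((m : ℝ) / n))) {z : ℂ × ℂ}
    (hz : z ∈ hartogs ((m : ℝ) / n)) (hz1 : z.1 ≠ 0) :
    monomialProjection m n K f z = f z := by
  have hm' : (0 : ℝ) < m := by exact_mod_cast hm
  have hf2 : MemLp f 2 (volOn (hartogs ((m : ℝ) / n))) := memLp_two_hartogs hm hn hp hf.2
  have hTd := differentiableOn_monomialProjection hm hn hK hf2
  have hcont : ∀ F : ℂ × ℂ → ℂ, DifferentiableOn ℂ F (hartogs ((m : ℝ) / n)) →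
      Continuous fun θ : UnitAddCircle × UnitAddCircle => F (torusRotation θ z) := fun F hF =>
    hF.continuousOn.comp_continuous (continuous_torusRotation.comp
      (by fun_prop : Continuous fun θ => (θ, z))) fun θ => torusRotation_mem_hartogs.2 hz
  have hcoeff : ∀ a b : ℤ, torusCoeff a b (monomialProjection m n K f) z = torusCoeff a b f z := by
    intro a b
    obtain ⟨c, hc⟩ := exists_torusCoeff_eq hn hf.1 a b
    rw [torusCoeff_monomialProjection hm hn hK hf2 a b hz, hc z hz hz1]
    have e : ∀ᵐ w ∂(volOn (hartogs ((m : ℝ) / n))),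
        torusCoeff a b (fun z => monomialKernel m n K z w) z * f w =
        (if 0 ≤ a ∧ K ≤ n * a + m * b then kernelMonomial m n a b z w else 0) * f w := by
      filter_upwards [ae_mem_hartogs hn] with w hw
      rw [torusCoeff_monomialKernel hm hn K a b hz hw]
    rw [integral_congr_ae e]
    by_cases h : 0 ≤ a ∧ K ≤ n * a + m * b
    · simp only [if_pos h]
      -- `hK` amounts to `-K < m + n`, so every monomial in the kernel is square integrable with
      -- nonzero norm denominator.
      have hpos : (0 : ℤ) < n * a + m * b + m + n := by
        have h1 : -(K : ℝ) < m + n := by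
          have : -(K : ℝ) / m * 2 = (-K * 2) / m := by ring
          rw [this, ← sub_pos] at hK
          have h2 : 2 + 2 * (n : ℝ) / m - -K * 2 / m = 2 * (m + n + K) / m := by
            field_simp
            ring
          rw [h2] at hK
          have := (div_pos_iff_of_pos_right hm').1 hK
          linarith
        have h3 : -K < m + n := by exact_mod_cast h1
        linarith [h.2]
      obtain ⟨hmem, hnorm⟩ := memLp_two_monomial hm hn h.1 hpos
      have hi : Integrable (fun w : ℂ × ℂ => f w * conj (w.1 ^ a * w.2 ^ b))
          (volOn (hartogs ((m : ℝ) / n))) := hf2.integrable_mul hmem.star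
      have hI := integral_mul_conj_monomial hn hi hc
      rw [hnorm] at hI
      have e2 : ∀ w, kernelMonomial m n a b z w * f w = ((Real.pi : ℂ) ^ 2 * m)⁻¹ *
          (((a + 1 : ℤ) : ℂ) * ((n * a + m * b + m + n : ℤ) : ℂ)) * (z.1 ^ a * z.2 ^ b) *
          (f w * conj (w.1 ^ a * w.2 ^ b)) := by
        intro w
        rw [kernelMonomial, mul_zpow, mul_zpow]
        simp only [map_mul, map_zpow₀]
        ring
      simp_rw [e2]
      rw [integral_const_mul, hI]
      have h1 : ((a + 1 : ℤ) : ℂ) ≠ 0 := by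
        have : a + 1 ≠ 0 := by have := h.1; omega
        exact_mod_cast this
      have h2 : ((n * a + m * b + m + n : ℤ) : ℂ) ≠ 0 := by exact_mod_cast hpos.ne'
      have h3 : (m : ℂ) ≠ 0 := by exact_mod_cast hm.ne'
      have h4 : (Real.pi : ℂ) ≠ 0 := by exact_mod_cast Real.pi_ne_zero
      generalize ((a + 1 : ℤ) : ℂ) = A at *
      generalize ((n * a + m * b + m + n : ℤ) : ℂ) = B at *
      field_simp
    · simp only [if_neg h, zero_mul, integral_zero]
      -- The kernel omits this monomial, so the coefficient of `f` has to vanish; otherwise the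
      -- monomial would be in `L^p` and hence admissible.
      by_contra hne
      have hc0 : c ≠ 0 := by
        rintro rfl
        simp at hne
      obtain ⟨h1, h2⟩ := exponent_of_torusCoeff_ne_zero hm hn hp hf hc0 hc
      exact h ⟨h1, hK' _ h2⟩
  have hzero := eq_zero_of_torus_fourierCoeff_eq_zero
    (u := fun θ => monomialProjection m n K f (torusRotation θ z) - f (torusRotation θ z))
    ((hcont _ hTd).sub (hcont _ hf.1)) (fun a b => by
      have hi : ∀ F : ℂ × ℂ → ℂ, DifferentiableOn ℂ F (hartogs ((m : ℝ) / n)) →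
          Integrable fun θ : UnitAddCircle × UnitAddCircle =>
            (fourier (-a) θ.1 * fourier (-b) θ.2 * F (torusRotation θ z) : ℂ) := fun F hF =>
        (Continuous.mul (by fun_prop) (hcont F hF)).integrable_of_hasCompactSupport
          (HasCompactSupport.of_compactSpace _)
      simp_rw [mul_sub]
      rw [integral_sub (hi _ hTd) (hi _ hf.1)]
      exact sub_eq_zero.2 (hcoeff a b)) 0
  have hrot0 : torusRotation 0 z = z := by
    simp [torusRotation]
  rw [hrot0] at hzero
  exact sub_eq_zero.1 hzero

/-! ### Identification of the projection and best approximation -/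

theorem inner_toLp_two {X : Type*} [MeasurableSpace X] {μ : Measure X} {f g : X → ℂ}
    (hf : MemLp f 2 μ) (hg : MemLp g 2 μ) :
    inner ℂ (hf.toLp f) (hg.toLp g) = ∫ x, conj (f x) * g x ∂μ := by
  rw [L2.inner_def]
  refine integral_congr_ae ?_
  filter_upwards [hf.coeFn_toLp, hg.coeFn_toLp] with x h1 h2
  rw [h1, h2, RCLike.inner_apply, mul_comm]

/-- The least exponent `n * a + m * b` of a monomial `z₁ ^ a * z₂ ^ b` in `L^p(hartogs (m / n))`. -/
theorem exists_least_exponent {m n : ℕ} (hm : 0 < m) {p : ℝ} (hp : 2 ≤ p) :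
    ∃ K : ℤ, K ≤ 0 ∧ -(K : ℝ) / m * p < 2 + 2 * n / m ∧ -(K : ℝ) / m * 2 < 2 + 2 * n / m ∧
      ∀ k : ℤ, -(2 * (m + n) : ℝ) < k * p → K ≤ k := by
  have hp0 : 0 < p := by linarith
  have hm' : (0 : ℝ) < m := by exact_mod_cast hm
  -- The integrability condition is strict, so the least admissible integer is the floor plus one,
  -- even when the quotient is an integer.
  have hK0 : ⌊-(2 * (m + n) : ℝ) / p⌋ + 1 ≤ 0 := by
    have h : ⌊-(2 * (m + n) : ℝ) / p⌋ < 0 := by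
      rw [Int.floor_lt, Int.cast_zero]
      exact div_neg_of_neg_of_pos (by linarith [(Nat.cast_nonneg n : (0 : ℝ) ≤ n)]) hp0
    omega
  have hKp : -(2 * (m + n) : ℝ) < ((⌊-(2 * (m + n) : ℝ) / p⌋ + 1 : ℤ) : ℝ) * p := by
    have := Int.lt_floor_add_one (-(2 * (m + n) : ℝ) / p)
    rw [div_lt_iff₀ hp0] at this
    exact_mod_cast this
  generalize hK : ⌊-(2 * (m + n) : ℝ) / p⌋ + 1 = K at hK0 hKp
  have h0 : 0 ≤ -(K : ℝ) / m :=
    div_nonneg (by have : (K : ℝ) ≤ 0 := by exact_mod_cast hK0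
                   linarith) hm'.le
  have hKm : -(K : ℝ) / m * p < 2 + 2 * n / m := by
    have e1 : -(K : ℝ) / m * p = -(K * p) / m := by ring
    have e2 : (2 : ℝ) + 2 * n / m = 2 * (m + n) / m := by
      field_simp
    rw [e1, e2, div_lt_div_iff_of_pos_right hm']
    linarith
  refine ⟨K, hK0, hKm, lt_of_le_of_lt (mul_le_mul_of_nonneg_left hp h0) hKm, fun k hk => ?_⟩
  rw [← hK]
  have : ⌊-(2 * (m + n) : ℝ) / p⌋ < k := by
    rw [Int.floor_lt, div_lt_iff₀ hp0]
    exact hk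
  omega

theorem propositionT (m n : ℕ) (hm : 0 < m) (hn : 0 < n) (hmn : Nat.Coprime m n)
    (p : ℝ) (hp : 2 ≤ p) (g : ℂ × ℂ → ℂ)
    (hg : MemLp g (ENNReal.ofReal p) (volOn (hartogs ((m : ℝ) / n)))) :
    ∃ G ∈ bergmanSpace (ENNReal.ofReal p) (hartogs ((m : ℝ) / n)),
      subBergmanProjection (ENNReal.ofReal p) (hartogs ((m : ℝ) / n))
          ((memLp_two_hartogs hm hn hp hg).toLp g) =ᵐ[volOn (hartogs ((m : ℝ) / n))] G ∧
      ∀ h ∈ bergmanSpace (ENNReal.ofReal p) (hartogs ((m : ℝ) / n)),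
        eLpNorm (g - G) 2 (volOn (hartogs ((m : ℝ) / n))) ≤
            eLpNorm (g - h) 2 (volOn (hartogs ((m : ℝ) / n))) ∧
        (eLpNorm (g - G) 2 (volOn (hartogs ((m : ℝ) / n))) =
            eLpNorm (g - h) 2 (volOn (hartogs ((m : ℝ) / n))) ↔
          EqOn h G (hartogs ((m : ℝ) / n))) := by
  obtain ⟨K, hK0, hKp, hK2, hKle⟩ := exists_least_exponent (n := n) hm hp
  have hopen : IsOpen (hartogs ((m : ℝ) / n)) := isOpen_hartogs hn
  have hg2 := memLp_two_hartogs hm hn hp hg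
  set G := monomialProjection m n K g with hGdef
  have hGp : MemLp G (ENNReal.ofReal p) (volOn (hartogs ((m : ℝ) / n))) :=
    memLp_monomialProjection hm hn hK0 hp hKp hg
  have hG2 := memLp_two_hartogs hm hn hp hGp
  have hG : G ∈ bergmanSpace (ENNReal.ofReal p) (hartogs ((m : ℝ) / n)) :=
    ⟨differentiableOn_monomialProjection hm hn hK2 hg2, hGp⟩
  -- Symmetry moves the operator onto `h`, which it reproduces almost everywhere.
  have horth : ∀ h ∈ bergmanSpace (ENNReal.ofReal p) (hartogs ((m : ℝ) / n)),
      ∀ hh : MemLp h 2 (volOn (hartogs ((m : ℝ) / n))),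
      inner ℂ (hh.toLp h) (hg2.toLp g - hG2.toLp G) = 0 := by
    intro h hhB hh
    rw [inner_sub_right, inner_toLp_two, inner_toLp_two, hGdef,
      integral_conj_mul_monomialProjection hm hn hK0 hp hKp hhB.2 hg, sub_eq_zero]
    refine integral_congr_ae ?_
    filter_upwards [ae_mem_hartogs hn, ae_fst_ne_zero _] with z hz hz1
    rw [monomialProjection_eq_self hm hn hp hK2 hKle hhB hz hz1]
  refine ⟨G, hG, ?_, fun h hh => ?_⟩
  · have hmem : hG2.toLp G ∈ closedSpanBergman (ENNReal.ofReal p) (hartogs ((m : ℝ) / n)) :=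
      Submodule.le_topologicalClosure _ (Submodule.subset_span ⟨G, hG, hG2.coeFn_toLp⟩)
    have hperp : hg2.toLp g - hG2.toLp G ∈
        (closedSpanBergman (ENNReal.ofReal p) (hartogs ((m : ℝ) / n)))ᗮ := by
      -- Orthogonality passes from the generators to their span and its closure, so no description
      -- of the closure is needed.
      rw [closedSpanBergman, Submodule.orthogonal_closure, Submodule.mem_orthogonal]
      intro u hu
      induction hu using Submodule.span_induction with
      | mem u hu =>
        obtain ⟨h, hh, huh⟩ := hu
        have hh2 := memLp_two_hartogs hm hn hp hh.2
        have : u = hh2.toLp h := Lp.ext (huh.trans hh2.coeFn_toLp.symm)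
        rw [this]
        exact horth h hh hh2
      | zero => exact inner_zero_left _
      | add x y _ _ hx hy => rw [inner_add_left, hx, hy, add_zero]
      | smul c x _ hx => rw [inner_smul_left, hx, mul_zero]
    have : CompleteSpace (closedSpanBergman (ENNReal.ofReal p) (hartogs ((m : ℝ) / n))) :=
      Submodule.topologicalClosure.completeSpace _
    have hproj : subBergmanProjection (ENNReal.ofReal p) (hartogs ((m : ℝ) / n)) (hg2.toLp g) =
        hG2.toLp G := Submodule.eq_starProjection_of_mem_orthogonal hmem hperp
    rw [hproj]
    exact hG2.coeFn_toLp
  · have hh2 := memLp_two_hartogs hm hn hp hh.2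
    -- `G - h` is orthogonal to `g - G` because `G` and `h` are both in `A^p`.
    have hpyth : ‖(hg2.sub hh2).toLp (g - h)‖ * ‖(hg2.sub hh2).toLp (g - h)‖ =
        ‖(hg2.sub hG2).toLp (g - G)‖ * ‖(hg2.sub hG2).toLp (g - G)‖ +
          ‖hG2.toLp G - hh2.toLp h‖ * ‖hG2.toLp G - hh2.toLp h‖ := by
      rw [MemLp.toLp_sub hg2 hh2, MemLp.toLp_sub hg2 hG2,
        ← norm_add_sq_eq_norm_sq_add_norm_sq_of_inner_eq_zero (𝕜 := ℂ), sub_add_sub_cancel]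
      rw [← inner_conj_symm, inner_sub_left, horth G hG hG2, horth h hh hh2, sub_zero, map_zero]
    rw [← Lp.enorm_toLp (hg2.sub hG2), ← Lp.enorm_toLp (hg2.sub hh2), enorm_le_iff_norm_le]
    refine ⟨?_, ?_, ?_⟩
    · exact (mul_self_le_mul_self_iff (norm_nonneg _) (norm_nonneg _)).2
        (by rw [hpyth]; exact le_add_of_nonneg_right (mul_self_nonneg _))
    · intro heq
      have heq' : ‖(hg2.sub hG2).toLp (g - G)‖ = ‖(hg2.sub hh2).toLp (g - h)‖ := by
        rw [← toReal_enorm, heq, toReal_enorm]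
      rw [heq'] at hpyth
      -- Equality of the distances kills the Pythagorean remainder. The resulting almost everywhere
      -- equality holds at every point of the domain, both functions being continuous on an open
      -- set.
      have h0 : hG2.toLp G - hh2.toLp h = 0 := norm_eq_zero.1 (mul_self_eq_zero.1 (by linarith))
      have hae : h =ᵐ[volOn (hartogs ((m : ℝ) / n))] G :=
        ((MemLp.toLp_eq_toLp_iff hG2 hh2).1 (sub_eq_zero.1 h0)).symm
      exact Measure.eqOn_open_of_ae_eq hae hopen hh.1.continuousOn hG.1.continuousOn
    · intro heq
      congr 1
      rw [MemLp.toLp_eq_toLp_iff]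
      filter_upwards [ae_mem_hartogs hn] with z hz
      rw [Pi.sub_apply, Pi.sub_apply, heq hz]
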